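/- **Setting.** Let $n\ge 2$, let $S:\mathbb R^n\to\mathbb R^n$ be a $C^1$ vector field which generates a complete flow $\phi:(t,w)\mapsto t_\cdot w$, and let $\Lambda\subset\mathbb R^n$ be a closed $\phi$-invariant set such that - (U1) $S'$ is bounded on $\Lambda$; - (U2) $\|S\|$ is bounded, and bounded away from $0$, on $\Lambda$; - (U3) for every $\epsilon>0$ there is $\delta>0$ such that $\|S'(w)-S'(\mathfrak w)\|<\epsilon$ whenever $\mathfrak w\in\Lambda$, $w\in\mathbb R^n$ and $\|w-\mathfrak w\|<\delta$. **Moving frames.** For $w\in\Lambda$ let $\mathbb T_w=\{x\in\mathbb R^n:\langle S(w),x\rangle=0\}$. The local Poincaré map $\psi_{t,w}$ from a neighborhood of $0$ in $\mathbb T_w$ to $\mathbb T_{t_\cdot w}$ is $\psi_{t,w}x=\phi(\tau(x),w+x)-t_\cdot w$, where $\tau$ is the locally unique differentiable function with $\tau(0)=t$ and $\phi(\tau(x),w+x)-t_\cdot w\in\mathbb T_{t_\cdot w}$; let $\Psi_{t,w}=D_0\psi_{t,w}:\mathbb T_w\to\mathbb T_{t_\cdot w}$. Let $\mathscr F$ be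 the set of pairs $(w,\gamma)$ with $w\in\Lambda$ and $\gamma=(u_1,\dots,u_{n-1})$ an orthonormal basis of $\mathbb T_w$; write $\gamma y=\sum_j y^ju_j$ for $y\in\mathbb R^{n-1}$. Let $\chi_{t,w}\gamma$ be the Gram–Schmidt orthonormalization of $(\Psi_{t,w}u_1,\dots,\Psi_{t,w}u_{n-1})$. Define $C_{w,\gamma}(t)\in GL(n-1,\mathbb R)$ by $\Psi_{t,w}(\gamma y)=(\chi_{t,w}\gamma)\,C_{w,\gamma}(t)y$, put $R^*_{w,\gamma}(t)=C_{w,\gamma}'(t)\,C_{w,\gamma}(t)^{-1}$ and $$\mathcal P_{w,\gamma}(t,y)=t_\cdot w+(\chi_{t,w}\gamma)y\qquad (t,y)\in\mathbb R\times\mathbb R^{n-1}.$$ **Standard system of a $C^1$ vector field $V$.** Wherever $D\mathcal P_{w,\gamma}(t,y)$ is invertible, define $\widehat V_{w,\gamma}=(\widehat V^0_{w,\gamma},\dots,\widehat V^{n-1}_{w,\gamma})$ by $D\mathcal P_{w,\gamma}(t,y)\,\widehat V_{w,\gamma}(t,y)=V(\mathcal P_{w,\gamma}(t,y))$; where $\widehat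 V^0_{w,\gamma}\neq0$, let $$V^*_{w,\gamma}=\frac{1}{\widehat V^0_{w,\gamma}}\bigl(\widehat V^1_{w,\gamma},\dots,\widehat V^{n-1}_{w,\gamma}\bigr),\qquad V^*_{\mathrm{rem}(w,\gamma)}(t,y)=V^*_{w,\gamma}(t,y)-R^*_{w,\gamma}(t)y .$$ **Neighborhoods.** Let $\|X\|_1=\sup_{w\in\mathbb R^n}(\|X(w)\|+\|X'(w)\|)\in[0,\infty]$. A *$C^1$-neighborhood of $S$* is a set of $C^1$ vector fields $V$ with $\|V-S\|_1<\infty$ that contains $\{V\in C^1:\|V-S\|_1<r\}$ for some $r>0$. Put $\mathbb R^{n-1}_c=\{y\in\mathbb R^{n-1}:\|y\|<c\}$. **Theorem 2.13.** There is $\mathfrak c_0>0$ such that for every $\mathfrak c\in(0,\mathfrak c_0]$ the following holds. For all $(w,\gamma)\in\mathscr F$ the map $\mathcal P_{w,\gamma}$ is $C^1$ and its derivative is invertible at every point of $\mathbb R\times\mathbb R^{n-1}_{\mathfrak c}$. There is a $C^1$-neighborhood $\mathcal N_S$ of $S$ such that $$\tfrac12\le\widehat V^0_{w,\gamma}(t,y)\le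 2\quad\text{for all }V\in\mathcal N_S,\ (w,\gamma)\in\mathscr F,\ (t,y)\in\mathbb R\times\mathbb R^{n-1}_{\mathfrak c},\tag{$*$}$$ and for every $C^1$-neighborhood $\mathcal N_S$ of $S$ with $(*)$: 1. For every $V\in\mathcal N_S$ and $(w,\gamma)\in\mathscr F$ there is $L>0$ such that $\|V^*_{\mathrm{rem}(w,\gamma)}(t,y)-V^*_{\mathrm{rem}(w,\gamma)}(t,y')\|\le L\|y-y'\|$ for all $t\in\mathbb R$ and $y,y'\in\mathbb R^{n-1}_{\mathfrak c}$. 2. For every $\eta>0$ there are a $C^1$-neighborhood $\mathcal U'\subset\mathcal N_S$ of $S$ and $\xi'\in(0,\mathfrak c]$ such that $\|V^*_{\mathrm{rem}(w,\gamma)}(t,y)\|\le\eta\,\xi'$ for all $V\in\mathcal U'$, $(w,\gamma)\in\mathscr F$, $t\in\mathbb R$ and $y\in\mathbb R^{n-1}_{\xi'}$. 3. For every $\kappa>0$ there are a $C^1$-neighborhood $\mathcal U''\subset\mathcal N_S$ of $S$ and $\xi''\in(0,\mathfrak c]$ such that $\|V^*_{\mathrm{rem}(w,\gamma)}(t,y)-V^*_{\mathrm{rem}(w,\gamma)}(t,y')\|\le\kappa\|y-y'\|$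 for all $V\in\mathcal U''$, $(w,\gamma)\in\mathscr F$, $t\in\mathbb R$ and $y,y'\in\mathbb R^{n-1}_{\xi''}$. -/

import Mathlib

open Set Filter Topology
open scoped ENNReal

namespace Liao

noncomputable section

/-- The Euclidean space of dimension `n`. -/
abbrev Euc (n : ℕ) : Type := EuclideanSpace ℝ (Fin n)

/-- `φ` is the (complete) flow of the vector field `S`: `φ t w` is the position at time `t` of the
solution of `w' = S w` that starts at `w`. -/
structure IsFlow {n : ℕ} (S : Euc n → Euc n) (φ : ℝ → Euc n → Euc n) : Prop where
  zero : ∀ w, φ 0 w = w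
  hasDerivAt : ∀ t w, HasDerivAt (fun s => φ s w) (S (φ t w)) t

/-- (U1) The derivative of `S` is bounded on `Λ`. -/
def CondU1 {n : ℕ} (S : Euc n → Euc n) (Λ : Set (Euc n)) : Prop :=
  ∃ K : ℝ, ∀ w ∈ Λ, ‖fderiv ℝ S w‖ ≤ K

/-- (U2) The speed `‖S w‖` is bounded, and bounded away from zero, on `Λ`. -/
def CondU2 {n : ℕ} (S : Euc n → Euc n) (Λ : Set (Euc n)) : Prop :=
  ∃ a b : ℝ, 0 < a ∧ ∀ w ∈ Λ, a ≤ ‖S w‖ ∧ ‖S w‖ ≤ b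

/-- (U3) The derivative of `S` is uniformly continuous at `Λ`; the point `w` is not restricted
to `Λ`. -/
def CondU3 {n : ℕ} (S : Euc n → Euc n) (Λ : Set (Euc n)) : Prop :=
  ∀ ε : ℝ, 0 < ε → ∃ δ : ℝ, 0 < δ ∧ ∀ v ∈ Λ, ∀ w : Euc n, ‖w - v‖ < δ →
    ‖fderiv ℝ S w - fderiv ℝ S v‖ < ε

/-! ### The cross-section flow and its linearization -/

/-- The transversal space `T_w = {x | ⟪S w, x⟫ = 0}`. The cross-section at `w` is `w + T_w`. -/
abbrev Transversal {n : ℕ} (S : Euc n → Euc n) (w : Euc n) : Submodule ℝ (Euc n) :=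
  (Submodule.span ℝ {S w})ᗮ

/-- `τ` is a transition time from the cross-section at `w` to the cross-section at `φ t w`: for
small `x ∈ T_w`, the orbit of `w + x` is on the second cross-section at time `τ x`. The branch is
the one with `τ 0 = t`; when `S` does not vanish at `φ t w`, its germ at `0` is unique. -/
def IsTransitionTime {n : ℕ} (S : Euc n → Euc n) (φ : ℝ → Euc n → Euc n) (t : ℝ) (w : Euc n)
    (τ : Transversal S w → ℝ) : Prop :=
  τ 0 = t ∧ DifferentiableAt ℝ τ 0 ∧
    ∀ᶠ x : Transversal S w in 𝓝 0, φ (τ x) (w + x) - φ t w ∈ Transversal S (φ t w)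

/-- A transition time from the cross-section at `w` to the one at `φ t w`. -/
def transitionTime {n : ℕ} (S : Euc n → Euc n) (φ : ℝ → Euc n → Euc n) (t : ℝ) (w : Euc n) :
    Transversal S w → ℝ :=
  Classical.epsilon (IsTransitionTime S φ t w)

open Classical in
/-- The local cross-section (Poincaré) map `ψ_{t,w} : T_w → T_{φ t w}`,
`x ↦ φ (τ x) (w + x) - φ t w`, extended by `0` to the points where it is not defined (none of
them close to `0`). -/
def crossMap {n : ℕ} (S : Euc n → Euc n) (φ : ℝ → Euc n → Euc n) (t : ℝ) (w : Euc n)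
    (x : Transversal S w) : Transversal S (φ t w) :=
  if h : φ (transitionTime S φ t w x) (w + x) - φ t w ∈ Transversal S (φ t w) then
    ⟨φ (transitionTime S φ t w x) (w + x) - φ t w, h⟩
  else 0

/-- The linear skew-product flow transversal to `S`: `Ψ_{t,w} : T_w → T_{φ t w}` is the derivative
of the cross-section map `ψ_{t,w}` at `0`. -/
def Psi {n : ℕ} (S : Euc n → Euc n) (φ : ℝ → Euc n → Euc n) (t : ℝ) (w : Euc n) :
    Transversal S w →L[ℝ] Transversal S (φ t w) :=
  fderiv ℝ (crossMap S φ t w) 0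

/-! ### Moving frames

A transversal orthonormal frame at `w` is a family `γ : Fin (n - 1) → Transversal S w` with
`Orthonormal ℝ γ`. -/

/-- The moving frame `χ_{t,w} γ` at `φ t w`: the columns of `γ` are transported by `Ψ_{t,w}` and
then orthonormalized by the Gram-Schmidt process. -/
def chi {n : ℕ} (S : Euc n → Euc n) (φ : ℝ → Euc n → Euc n) (w : Euc n)
    (γ : Fin (n - 1) → Transversal S w) (t : ℝ) : Fin (n - 1) → Transversal S (φ t w) :=
  InnerProductSpace.gramSchmidtNormed ℝ (fun j => Psi S φ t w (γ j))

/-- The linear map `y ↦ γ y = ∑ j, y j • γ j` of a family `γ` of vectors. -/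
def frameMap {m : ℕ} {G : Type*} [NormedAddCommGroup G] [NormedSpace ℝ G] (γ : Fin m → G) :
    Euc m →L[ℝ] G :=
  ∑ j, (EuclideanSpace.proj j : Euc m →L[ℝ] ℝ).smulRight (γ j)

/-- `Ψ_{t,w}` in the coordinates of the moving frame: `C(t) = T_{χ γ}⁻¹ ∘ Ψ_{t,w} ∘ T_γ`. -/
def frameC {n : ℕ} (S : Euc n → Euc n) (φ : ℝ → Euc n → Euc n) (w : Euc n)
    (γ : Fin (n - 1) → Transversal S w) (t : ℝ) : Euc (n - 1) →L[ℝ] Euc (n - 1) :=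
  (frameMap (chi S φ w γ t)).inverse ∘L Psi S φ t w ∘L frameMap γ

/-- The coefficient of the reduced linearized system, `R(t) = C'(t) C(t)⁻¹`. -/
def frameR {n : ℕ} (S : Euc n → Euc n) (φ : ℝ → Euc n → Euc n) (w : Euc n)
    (γ : Fin (n - 1) → Transversal S w) (t : ℝ) : Euc (n - 1) →L[ℝ] Euc (n - 1) :=
  deriv (frameC S φ w γ) t ∘L (frameC S φ w γ t).inverse

/-- The map `P(t, y) = φ t w + (χ_{t,w} γ) y`. -/
def frameP {n : ℕ} (S : Euc n → Euc n) (φ : ℝ → Euc n → Euc n) (w : Euc n)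
    (γ : Fin (n - 1) → Transversal S w) (p : ℝ × Euc (n - 1)) : Euc n :=
  φ p.1 w + (frameMap (chi S φ w γ p.1) p.2 : Euc n)

/-! ### Lifting, standard system and remainder of a vector field `V` -/

/-- The lifting of `V`, defined by `DP(t, y) (lift V (t, y)) = V (P (t, y))`. -/
def lift {n : ℕ} (S : Euc n → Euc n) (φ : ℝ → Euc n → Euc n) (V : Euc n → Euc n) (w : Euc n)
    (γ : Fin (n - 1) → Transversal S w) (p : ℝ × Euc (n - 1)) : ℝ × Euc (n - 1) :=
  (fderiv ℝ (frameP S φ w γ) p).inverse (V (frameP S φ w γ p))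

/-- The standard system of `V` associated to `(S, (w, γ))`: the last `n - 1` components of the
lifting divided by the first one. -/
def stdSys {n : ℕ} (S : Euc n → Euc n) (φ : ℝ → Euc n → Euc n) (V : Euc n → Euc n) (w : Euc n)
    (γ : Fin (n - 1) → Transversal S w) (t : ℝ) (y : Euc (n - 1)) : Euc (n - 1) :=
  (lift S φ V w γ (t, y)).1⁻¹ • (lift S φ V w γ (t, y)).2

/-- The remainder of the standard system of `V`: `V_rem(t, y) = V*(t, y) - R(t) y`. -/
def stdRem {n : ℕ} (S : Euc n → Euc n) (φ : ℝ → Euc n → Euc n) (V : Euc n → Euc n) (w : Euc n)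
    (γ : Fin (n - 1) → Transversal S w) (t : ℝ) (y : Euc (n - 1)) : Euc (n - 1) :=
  stdSys S φ V w γ t y - frameR S φ w γ t y

/-! ### Neighborhoods and the standing choices -/

/-- The `C¹` norm of a vector field on the whole space (possibly infinite). -/
def c1Norm {n : ℕ} (X : Euc n → Euc n) : ℝ≥0∞ :=
  ⨆ w, (‖X w‖ₑ + ‖fderiv ℝ X w‖ₑ)

/-- `N` is a `C¹`-neighborhood of `S`: a set of `C¹` vector fields at finite `C¹`-distance from
`S` that contains a ball of positive radius about `S`. -/
def IsC1Nhd {n : ℕ} (S : Euc n → Euc n) (N : Set (Euc n → Euc n)) : Prop :=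
  (∀ V ∈ N, ContDiff ℝ 1 V ∧ c1Norm (V - S) < ⊤) ∧
    ∃ r : ℝ≥0∞, 0 < r ∧ ∀ V : Euc n → Euc n, ContDiff ℝ 1 V → c1Norm (V - S) < r → V ∈ N

/-- For every transversal orthonormal frame over `Λ`, the map `P` is `C¹` and is a local
diffeomorphism (its derivative is invertible) at every point `(t, y)` with `‖y‖ < c`. -/
def IsTubeRadius {n : ℕ} (S : Euc n → Euc n) (φ : ℝ → Euc n → Euc n) (Λ : Set (Euc n))
    (c : ℝ) : Prop :=
  ∀ w ∈ Λ, ∀ γ : Fin (n - 1) → Transversal S w, Orthonormal ℝ γ →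
    ContDiff ℝ 1 (frameP S φ w γ) ∧
      ∀ t : ℝ, ∀ y ∈ Metric.ball (0 : Euc (n - 1)) c,
        (fderiv ℝ (frameP S φ w γ) (t, y)).IsInvertible

/-- For every `V ∈ N` and every transversal orthonormal frame over `Λ`, the first component of the
lifting of `V` lies in `[1/2, 2]` at every point `(t, y)` with `‖y‖ < c`. -/
def HasTimeBounds {n : ℕ} (S : Euc n → Euc n) (φ : ℝ → Euc n → Euc n) (Λ : Set (Euc n))
    (c : ℝ) (N : Set (Euc n → Euc n)) : Prop :=
  ∀ V ∈ N, ∀ w ∈ Λ, ∀ γ : Fin (n - 1) → Transversal S w, Orthonormal ℝ γ →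
    ∀ t : ℝ, ∀ y ∈ Metric.ball (0 : Euc (n - 1)) c,
      1 / 2 ≤ (lift S φ V w γ (t, y)).1 ∧ (lift S φ V w γ (t, y)).1 ≤ 2

end

end Liao

/-! Along an orbit in `Λ` write σ = S(φ t w), A = S'(φ t w), e_j for the moving frame and d_j for
its velocities. Put F y = Σ y^j e_j, D y = Σ y^j d_j, and let G be the adjoint of F. Then
DP(t,y)(s,z) = s(σ + D y) + F z. Pairing with σ, which is orthogonal to the frame, gives s(‖σ‖² +
⟨σ, D y⟩) = ⟨σ, V(P)⟩ for the time component s of the lift. Applying G gives the standard system s⁻¹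
G V(P) − G D y. The reduced linear coefficient is R y = G A F y − G D y, so the frame velocities
cancel (`stdRem_eq`) and the remainder is s⁻¹ G V(P) − G A F y.

Uniformity rests on a bound for the d_j that does not depend on t, w, γ, although Gram–Schmidt is
applied to vectors that may become nearly dependent. Such a bound exists because the process is
triangular: ⟨e_k, X u_i⟩ = 0 for i < k, with X the variational flow. Differentiating shows that
⟨d_k, ·⟩ = −⟨e_k, A ·⟩ on σ and on e_j for j < k; antisymmetry of ⟨e_j, d_k⟩ supplies the other
components (`norm_frameVel_le`).

With q = s⁻¹ and g = V(P), the difference of two remainders is q G(g − g' − A F(y − y')) + (q − 1) G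
A F(y − y') + (q − q') G(g' − σ). The first term is small by (U3) and C¹-closeness, the other two
because q is near 1 and g' is near σ (`norm_remainder_sub_le`). This gives the Lipschitz claims; the
size bound follows by adding the value at y = 0, which only V − S contributes to.

Identifying Ψ with the orthogonal projection of X needs the transition time, hence strict
differentiability of the flow at points of `Λ`, which is obtained from Grönwall estimates. -/

namespace Liao

noncomputable section

/-! ### Linear differential equations: fences, Grönwall, fundamental solutions. -/

section LinearODE

variable {E : Type*} [NormedAddCommGroup E] [NormedSpace ℝ E]

theorem hasDerivAt_comp_neg_of_forall {f f' : ℝ → E} (hf : ∀ t, HasDerivAt f (f' t) t) (t : ℝ) :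
    HasDerivAt (fun s => f (-s)) (-f' (-t)) t := by
  simpa [Function.comp_def] using (hf (-t)).scomp t (hasDerivAt_neg t)

/-- Two-sided fencing: the strict bound on the derivative is only needed at points where the norm
touches the fence. -/
theorem norm_le_of_deriv_lt_fence {f f' : ℝ → E} {B B' : ℝ → ℝ} {T : ℝ}
    (hf : ∀ t, HasDerivAt f (f' t) t) (h0 : ‖f 0‖ ≤ B 0) (hB : ∀ x, HasDerivAt B (B' x) x)
    (bound : ∀ t, |t| ≤ T → ‖f t‖ = B |t| → ‖f' t‖ < B' |t|) {t : ℝ} (ht : |t| ≤ T) :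
    ‖f t‖ ≤ B |t| := by
  rcases le_total 0 t with h | h
  · rw [abs_of_nonneg h] at ht ⊢
    refine image_norm_le_of_norm_deriv_right_lt_deriv_boundary (a := 0) (b := T)
      (fun x _ => (hf x).continuousAt.continuousWithinAt) (fun x _ => (hf x).hasDerivWithinAt)
      h0 hB (fun x hx he => ?_) ⟨h, ht⟩
    have := bound x (by rw [abs_of_nonneg hx.1]; exact hx.2.le)
    rw [abs_of_nonneg hx.1] at this
    exact this he
  · rw [abs_of_nonpos h] at ht ⊢
    have key := image_norm_le_of_norm_deriv_right_lt_deriv_boundary (a := 0) (b := T)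
      (f := fun s => f (-s)) (f' := fun s => -f' (-s))
      (fun x _ => (hasDerivAt_comp_neg_of_forall hf x).continuousAt.continuousWithinAt)
      (fun x _ => (hasDerivAt_comp_neg_of_forall hf x).hasDerivWithinAt)
      (by simpa using h0) hB (fun x hx he => by
        have := bound (-x) (by rw [abs_neg, abs_of_nonneg hx.1]; exact hx.2.le)
        rw [abs_neg, abs_of_nonneg hx.1] at this
        rw [norm_neg]
        exact this he) (x := -t) ⟨by linarith, ht⟩
    simpa using key

/-- Two-sided fencing with a bound on the derivative at all points. -/
theorem norm_le_of_deriv_le_fence {f f' : ℝ → E} {B B' : ℝ → ℝ}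
    (hf : ∀ t, HasDerivAt f (f' t) t) (h0 : ‖f 0‖ ≤ B 0) (hB : ∀ x, HasDerivAt B (B' x) x)
    (bound : ∀ t, ‖f' t‖ ≤ B' |t|) (t : ℝ) :
    ‖f t‖ ≤ B |t| := by
  rcases le_total 0 t with h | h
  · rw [abs_of_nonneg h]
    refine image_norm_le_of_norm_deriv_right_le_deriv_boundary (a := 0) (b := t)
      (fun x _ => (hf x).continuousAt.continuousWithinAt) (fun x _ => (hf x).hasDerivWithinAt)
      h0 hB (fun x hx => ?_) ⟨h, le_rfl⟩
    have := bound x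
    rwa [abs_of_nonneg hx.1] at this
  · rw [abs_of_nonpos h]
    have key := image_norm_le_of_norm_deriv_right_le_deriv_boundary (a := 0) (b := -t)
      (f := fun s => f (-s)) (f' := fun s => -f' (-s))
      (fun x _ => (hasDerivAt_comp_neg_of_forall hf x).continuousAt.continuousWithinAt)
      (fun x _ => (hasDerivAt_comp_neg_of_forall hf x).hasDerivWithinAt)
      (by simpa using h0) hB (fun x hx => by
        have := bound (-x)
        rw [abs_neg, abs_of_nonneg hx.1] at this
        rwa [norm_neg]) (x := -t) ⟨by linarith, le_rfl⟩
    simpa using key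

/-- Two-sided Grönwall inequality. -/
theorem norm_le_gronwallBound_abs {f f' : ℝ → E} {δ K ε T : ℝ}
    (hf : ∀ t, HasDerivAt f (f' t) t) (h0 : ‖f 0‖ ≤ δ)
    (bound : ∀ t, |t| ≤ T → ‖f' t‖ ≤ K * ‖f t‖ + ε) {t : ℝ} (ht : |t| ≤ T) :
    ‖f t‖ ≤ gronwallBound δ K ε |t| := by
  rcases le_total 0 t with h | h
  · rw [abs_of_nonneg h] at ht ⊢
    have := norm_le_gronwallBound_of_norm_deriv_right_le (a := 0) (b := T)
      (fun x _ => (hf x).continuousAt.continuousWithinAt) (fun x _ => (hf x).hasDerivWithinAt)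
      h0 (fun x hx => bound x (by rw [abs_of_nonneg hx.1]; exact hx.2.le)) t ⟨h, ht⟩
    simpa using this
  · rw [abs_of_nonpos h] at ht ⊢
    have := norm_le_gronwallBound_of_norm_deriv_right_le (a := 0) (b := T) (δ := δ) (K := K) (ε := ε)
      (f := fun s => f (-s)) (f' := fun s => -f' (-s))
      (fun x _ => (hasDerivAt_comp_neg_of_forall hf x).continuousAt.continuousWithinAt)
      (fun x _ => (hasDerivAt_comp_neg_of_forall hf x).hasDerivWithinAt)
      (by simpa using h0)
      (fun x hx => by
        rw [norm_neg]
        exact bound (-x) (by rw [abs_neg, abs_of_nonneg hx.1]; exact hx.2.le))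
      (-t) ⟨by linarith, ht⟩
    simpa using this

/-- Uniqueness for linear equations with bounded coefficients. -/
theorem eq_zero_of_hasDerivAt_linear {A : ℝ → E →L[ℝ] E} {K : ℝ} (hK : ∀ t, ‖A t‖ ≤ K)
    {f : ℝ → E} (hf : ∀ t, HasDerivAt f (A t (f t)) t) {t₀ : ℝ} (h0 : f t₀ = 0) (t : ℝ) :
    f t = 0 := by
  have hg : ∀ s, HasDerivAt (fun s => f (s + t₀)) (A (s + t₀) (f (s + t₀))) s := fun s =>
    (hf (s + t₀)).comp_add_const s t₀
  have := norm_le_gronwallBound_abs (δ := 0) (K := K) (ε := 0) (T := |t - t₀|) hg (by simp [h0])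
    (fun s _ => by
      rw [add_zero]
      exact ((A _).le_opNorm _).trans (by gcongr; exact hK _)) (t := t - t₀) le_rfl
  simpa [gronwallBound_ε0_δ0] using this

/-- The terms of the Picard series of the equation `X' = A X`, `X 0 = 1`. -/
def picardTerm (A : ℝ → E →L[ℝ] E) : ℕ → ℝ → E →L[ℝ] E
  | 0, _ => ContinuousLinearMap.id ℝ E
  | k + 1, t => ∫ s in (0 : ℝ)..t, A s ∘L picardTerm A k s

theorem continuous_picardTerm {A : ℝ → E →L[ℝ] E} (hA : Continuous A) (k : ℕ) :
    Continuous (picardTerm A k) := by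
  induction k with
  | zero => exact continuous_const
  | succ k ih =>
    exact intervalIntegral.continuous_primitive
      (fun a b => (hA.clm_comp ih).intervalIntegrable a b) 0

variable [CompleteSpace E]

theorem hasDerivAt_picardTerm_succ {A : ℝ → E →L[ℝ] E} (hA : Continuous A) (k : ℕ) (t : ℝ) :
    HasDerivAt (picardTerm A (k + 1)) (A t ∘L picardTerm A k t) t := by
  have hc := hA.clm_comp (continuous_picardTerm hA k)
  exact intervalIntegral.integral_hasDerivAt_right (hc.intervalIntegrable _ _)
    hc.stronglyMeasurable.stronglyMeasurableAtFilter hc.continuousAt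

theorem norm_picardTerm_le {A : ℝ → E →L[ℝ] E} (hA : Continuous A) {K : ℝ}
    (hK : ∀ t, ‖A t‖ ≤ K) (k : ℕ) (t : ℝ) :
    ‖picardTerm A k t‖ ≤ (K * |t|) ^ k / k.factorial := by
  have hK0 : 0 ≤ K := (norm_nonneg _).trans (hK 0)
  induction k generalizing t with
  | zero => simpa [picardTerm] using ContinuousLinearMap.norm_id_le
  | succ k ih =>
    refine norm_le_of_deriv_le_fence (B := fun t => (K * t) ^ (k + 1) / (k + 1).factorial)
      (B' := fun t => K * ((K * t) ^ k / k.factorial))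
      (hasDerivAt_picardTerm_succ hA k) (by simp [picardTerm]) (fun x => ?_) (fun s => ?_) t
    · have h := (((hasDerivAt_id x).const_mul K).pow (k + 1)).div_const ((k + 1).factorial : ℝ)
      refine h.congr_deriv ?_
      have : (k.factorial : ℝ) ≠ 0 := by positivity
      rw [Nat.factorial_succ]
      push_cast
      simp only [id]
      field_simp
    · exact (ContinuousLinearMap.opNorm_comp_le _ _).trans
        (mul_le_mul (hK s) (ih s) (norm_nonneg _) hK0)

/-- Linear equations with bounded continuous coefficients have global fundamental solutions. -/
theorem exists_fundamental_solution {A : ℝ → E →L[ℝ] E} (hA : Continuous A) {K : ℝ}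
    (hK : ∀ t, ‖A t‖ ≤ K) :
    ∃ X : ℝ → E →L[ℝ] E, X 0 = ContinuousLinearMap.id ℝ E ∧
      ∀ t, HasDerivAt X (A t ∘L X t) t := by
  have hK0 : 0 ≤ K := (norm_nonneg _).trans (hK 0)
  have hsum : ∀ t, Summable fun k => picardTerm A k t := fun t =>
    .of_norm_bounded (Real.summable_pow_div_factorial (K * |t|)) (norm_picardTerm_le hA hK · t)
  refine ⟨fun t => ∑' k, picardTerm A k t, ?_, fun t => ?_⟩
  · change ∑' k, picardTerm A k 0 = _
    rw [tsum_eq_single 0 (fun k hk => ?_)]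
    · rfl
    · obtain ⟨k, rfl⟩ := Nat.exists_eq_succ_of_ne_zero hk
      simp [picardTerm]
  · have hsum' : Summable fun k => picardTerm A (k + 1) t := (summable_nat_add_iff 1).2 (hsum t)
    have hd : HasDerivAt (fun z => ∑' k, picardTerm A (k + 1) z)
        (∑' k, A t ∘L picardTerm A k t) t := by
      -- The majorant of the differentiated series is uniform only on bounded time intervals, hence
      -- the ball of radius |t| + 1.
      refine hasDerivAt_tsum_of_isPreconnected (g := fun k => picardTerm A (k + 1))
        (g' := fun k s => A s ∘L picardTerm A k s) (y := t) (t := Metric.ball (0 : ℝ) (|t| + 1)) (y₀ := t)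
        (u := fun k => K * ((K * (|t| + 1)) ^ k / k.factorial))
        ((Real.summable_pow_div_factorial _).mul_left K) Metric.isOpen_ball
        (convex_ball _ _).isPreconnected (fun k y _ => hasDerivAt_picardTerm_succ hA k y)
        (fun k y hy => ?_) (by simp) hsum' (by simp)
      have hy' : |y| ≤ |t| + 1 := by simpa using (mem_ball_zero_iff.1 hy).le
      refine (ContinuousLinearMap.opNorm_comp_le _ _).trans
        (mul_le_mul (hK y) ((norm_picardTerm_le hA hK k y).trans ?_) (norm_nonneg _) hK0)
      gcongr
    have h1 : (fun z => ∑' k, picardTerm A k z) =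
        fun z => ContinuousLinearMap.id ℝ E + ∑' k, picardTerm A (k + 1) z := by
      funext z
      rw [(hsum z).tsum_eq_zero_add]
      rfl
    have h2 : A t ∘L ∑' k, picardTerm A k t = ∑' k, A t ∘L picardTerm A k t :=
      (ContinuousLinearMap.compL ℝ E E E (A t)).map_tsum (hsum t)
    change HasDerivAt _ (A t ∘L ∑' k, picardTerm A k t) t
    rw [h2, h1]
    exact hd.const_add _

end LinearODE

/-- The standing assumptions on `S`, its flow `φ` and the invariant set `Λ`, with named constants. -/
structure IsUniform {n : ℕ} (S : Euc n → Euc n) (φ : ℝ → Euc n → Euc n) (Λ : Set (Euc n))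
    (K a b : ℝ) : Prop where
  contDiff : ContDiff ℝ 1 S
  isFlow : IsFlow S φ
  invariant : ∀ t : ℝ, ∀ w ∈ Λ, φ t w ∈ Λ
  nonneg : 0 ≤ K
  norm_fderiv_le : ∀ w ∈ Λ, ‖fderiv ℝ S w‖ ≤ K
  pos : 0 < a
  le_speed : ∀ w ∈ Λ, a ≤ ‖S w‖
  speed_le : ∀ w ∈ Λ, ‖S w‖ ≤ b
  condU3 : CondU3 S Λ

/-! ### The flow near `Λ` and its variational equation. -/

namespace IsUniform

variable {n : ℕ} {S : Euc n → Euc n} {φ : ℝ → Euc n → Euc n} {Λ : Set (Euc n)} {K a b : ℝ}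
  {w : Euc n}

theorem ne_zero (h : IsUniform S φ Λ K a b) (hw : w ∈ Λ) (t : ℝ) : S (φ t w) ≠ 0 :=
  norm_pos_iff.1 (h.pos.trans_le (h.le_speed _ (h.invariant t w hw)))

theorem differentiable (h : IsUniform S φ Λ K a b) : Differentiable ℝ S :=
  h.contDiff.differentiable one_ne_zero

/-- The mean value inequality on a ball whose radius does not depend on its centre in `Λ`. All later
uses of (U3) go through this form. -/
theorem exists_norm_sub_sub_le (h : IsUniform S φ Λ K a b) {ε : ℝ} (hε : 0 < ε) :
    ∃ δ : ℝ, 0 < δ ∧ ∀ p ∈ Λ, ∀ v v' : Euc n, ‖v - p‖ < δ → ‖v' - p‖ < δ →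
      ‖S v - S v' - fderiv ℝ S p (v - v')‖ ≤ ε * ‖v - v'‖ := by
  obtain ⟨δ, hδ, H⟩ := h.condU3 ε hε
  refine ⟨δ, hδ, fun p hp v v' hv hv' => ?_⟩
  exact (convex_ball p δ).norm_image_sub_le_of_norm_fderiv_le' (𝕜 := ℝ)
    (fun x _ => h.differentiable x)
    (fun x hx => (H p hp x (mem_ball_iff_norm.1 hx)).le)
    (mem_ball_iff_norm.2 hv') (mem_ball_iff_norm.2 hv)

theorem norm_fderiv_apply_le (h : IsUniform S φ Λ K a b) (hw : w ∈ Λ) (t : ℝ) (v : Euc n) :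
    ‖fderiv ℝ S (φ t w) v‖ ≤ K * ‖v‖ :=
  (fderiv ℝ S (φ t w)).le_of_opNorm_le (h.norm_fderiv_le _ (h.invariant t w hw)) v

theorem norm_sub_le_of_norm_sub_sub_le (h : IsUniform S φ Λ K a b) (hw : w ∈ Λ) {t ε : ℝ}
    {v v' : Euc n} (H : ‖S v - S v' - fderiv ℝ S (φ t w) (v - v')‖ ≤ ε * ‖v - v'‖) :
    ‖S v - S v'‖ ≤ (K + ε) * ‖v - v'‖ := by
  have := norm_add_le (S v - S v' - fderiv ℝ S (φ t w) (v - v')) (fderiv ℝ S (φ t w) (v - v'))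
  rw [sub_add_cancel] at this
  linarith [h.norm_fderiv_apply_le hw t (v - v')]

theorem hasDerivAt_speed (h : IsUniform S φ Λ K a b) (w : Euc n) (t : ℝ) :
    HasDerivAt (fun s => S (φ s w)) (fderiv ℝ S (φ t w) (S (φ t w))) t :=
  (h.differentiable (φ t w)).hasFDerivAt.comp_hasDerivAt t (h.isFlow.hasDerivAt t w)

theorem continuous_orbit (h : IsUniform S φ Λ K a b) (w : Euc n) : Continuous fun t => φ t w :=
  continuous_iff_continuousAt.2 fun t => (h.isFlow.hasDerivAt t w).continuousAt

theorem continuous_fderiv_orbit (h : IsUniform S φ Λ K a b) (w : Euc n) :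
    Continuous fun t => fderiv ℝ S (φ t w) :=
  (h.contDiff.continuous_fderiv one_ne_zero).comp (h.continuous_orbit w)

/-- Orbits starting close to an orbit in `Λ` stay close to it for a bounded time. -/
theorem exists_norm_flow_sub_lt (h : IsUniform S φ Λ K a b) (hw : w ∈ Λ) (T : ℝ) {δ : ℝ}
    (hδ : 0 < δ) :
    ∃ ρ : ℝ, 0 < ρ ∧ ∀ x : Euc n, ‖x‖ < ρ → ∀ t : ℝ, |t| ≤ T →
      ‖φ t (w + x) - φ t w‖ < δ := by
  obtain ⟨δ₁, hδ₁, H⟩ := h.exists_norm_sub_sub_le one_pos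
  set δ' := min δ δ₁
  have hδ' : 0 < δ' := lt_min hδ hδ₁
  set M := Real.exp ((K + 2) * T)
  have hM : 0 < M := Real.exp_pos _
  have hK := h.nonneg
  refine ⟨δ' / (2 * M), by positivity, fun x hx t ht => ?_⟩
  set ρ := δ' / (2 * M)
  have hρ : 0 < ρ := by positivity
  have hρM : ρ * M < δ' := by
    have : ρ * M = δ' / 2 := by simp only [ρ]; field_simp
    linarith
  have hexp : ∀ s : ℝ, |s| ≤ T → ρ * Real.exp ((K + 2) * |s|) < δ' := fun s hs => by
    refine lt_of_le_of_lt ?_ hρM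
    gcongr
    exact Real.exp_le_exp.2 (by gcongr)
  -- A bootstrap: the fence stays below `δ₁`, so where the distance touches it the local Lipschitz
  -- constant K + 1 applies. The exponent K + 2 makes the comparison strict.
  have key := norm_le_of_deriv_lt_fence (f := fun s => φ s (w + x) - φ s w)
    (f' := fun s => S (φ s (w + x)) - S (φ s w)) (B := fun s => ρ * Real.exp ((K + 2) * s))
    (B' := fun s => ρ * (Real.exp ((K + 2) * s) * (K + 2))) (T := T)
    (fun s => (h.isFlow.hasDerivAt s _).sub (h.isFlow.hasDerivAt s _))
    (by simpa [h.isFlow.zero] using hx.le)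
    (fun s => by simpa using ((((hasDerivAt_id s).const_mul (K + 2)).exp).const_mul ρ))
    (fun s hs he => by
      have h1 : ‖φ s (w + x) - φ s w‖ < δ₁ := by
        rw [he]; exact (hexp s hs).trans_le (min_le_right _ _)
      have h2 := h.norm_sub_le_of_norm_sub_sub_le hw
        (H _ (h.invariant s w hw) _ (φ s w) h1 (by simpa using hδ₁))
      refine h2.trans_lt ?_
      rw [he]
      have : 0 < ρ * Real.exp ((K + 2) * |s|) := by positivity
      nlinarith) ht
  exact key.trans_lt ((hexp t ht).trans_le (min_le_left _ _))

/-- `X` is the fundamental solution of the variational equation along the orbit of `w`. -/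
def _root_.Liao.IsVariational (S : Euc n → Euc n) (φ : ℝ → Euc n → Euc n) (w : Euc n)
    (X : ℝ → Euc n →L[ℝ] Euc n) : Prop :=
  X 0 = ContinuousLinearMap.id ℝ (Euc n) ∧ ∀ t, HasDerivAt X (fderiv ℝ S (φ t w) ∘L X t) t

theorem exists_isVariational (h : IsUniform S φ Λ K a b) (hw : w ∈ Λ) :
    ∃ X, IsVariational S φ w X :=
  exists_fundamental_solution (h.continuous_fderiv_orbit w)
    fun t => h.norm_fderiv_le _ (h.invariant t w hw)

theorem _root_.Liao.IsVariational.hasDerivAt_apply {X : ℝ → Euc n →L[ℝ] Euc n}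
    (hX : IsVariational S φ w X) (v : Euc n) (t : ℝ) :
    HasDerivAt (fun s => X s v) (fderiv ℝ S (φ t w) (X t v)) t := by
  simpa using (hX.2 t).clm_apply (hasDerivAt_const t v)

/-- The flow is uniformly strictly differentiable in the space variable along an orbit in `Λ`. -/
theorem exists_norm_flow_sub_sub_le (h : IsUniform S φ Λ K a b) (hw : w ∈ Λ)
    {X : ℝ → Euc n →L[ℝ] Euc n} (hX : IsVariational S φ w X) (T : ℝ) {ε : ℝ} (hε : 0 < ε) :
    ∃ ρ : ℝ, 0 < ρ ∧ ∀ x x' : Euc n, ‖x‖ < ρ → ‖x'‖ < ρ → ∀ t : ℝ, |t| ≤ T →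
      ‖φ t (w + x) - φ t (w + x') - X t (x - x')‖ ≤ ε * ‖x - x'‖ := by
  have hK := h.nonneg
  set L := K + 1
  have hL : 1 ≤ L := by simp only [L]; linarith
  set M := Real.exp (L * T)
  have hM : 0 < M := Real.exp_pos _
  set ε' := ε / (M * M)
  have hε' : 0 < ε' := by positivity
  obtain ⟨δ₁, hδ₁, H₁⟩ := h.exists_norm_sub_sub_le one_pos
  obtain ⟨δ₂, hδ₂, H₂⟩ := h.exists_norm_sub_sub_le hε'
  obtain ⟨ρ, hρ, Hρ⟩ := h.exists_norm_flow_sub_lt hw T (lt_min hδ₁ hδ₂)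
  refine ⟨ρ, hρ, fun x x' hx hx' t ht => ?_⟩
  have hexp : ∀ s : ℝ, |s| ≤ T → Real.exp (L * |s|) ≤ M := fun s hs =>
    Real.exp_le_exp.2 (by gcongr)
  have hlip : ∀ s : ℝ, |s| ≤ T → ‖φ s (w + x) - φ s (w + x')‖ ≤ ‖x - x'‖ * M := by
    intro s hs
    have := norm_le_gronwallBound_abs (f := fun s => φ s (w + x) - φ s (w + x'))
      (f' := fun s => S (φ s (w + x)) - S (φ s (w + x'))) (δ := ‖x - x'‖) (K := L) (ε := 0) (T := T)
      (fun s => (h.isFlow.hasDerivAt s _).sub (h.isFlow.hasDerivAt s _))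
      (by simp [h.isFlow.zero]) (fun s hs => by
        rw [add_zero]
        exact h.norm_sub_le_of_norm_sub_sub_le hw
          (H₁ _ (h.invariant s w hw) _ _ ((Hρ x hx s hs).trans_le (min_le_left _ _))
            ((Hρ x' hx' s hs).trans_le (min_le_left _ _)))) hs
    rw [gronwallBound_ε0] at this
    exact this.trans (by gcongr; exact hexp s hs)
  have key := norm_le_gronwallBound_abs
    (f := fun s => φ s (w + x) - φ s (w + x') - X s (x - x'))
    (f' := fun s => S (φ s (w + x)) - S (φ s (w + x')) - fderiv ℝ S (φ s w) (X s (x - x')))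
    (δ := 0) (K := L) (ε := ε' * (‖x - x'‖ * M)) (T := T)
    (fun s => ((h.isFlow.hasDerivAt s _).sub (h.isFlow.hasDerivAt s _)).sub
      (hX.hasDerivAt_apply _ s))
    (by simp [h.isFlow.zero, hX.1]) (fun s hs => by
      have h1 := H₂ _ (h.invariant s w hw) _ _ ((Hρ x hx s hs).trans_le (min_le_right _ _))
            ((Hρ x' hx' s hs).trans_le (min_le_right _ _))
      have h2 := h.norm_fderiv_apply_le hw s (φ s (w + x) - φ s (w + x') - X s (x - x'))
      have h3 := norm_add_le (S (φ s (w + x)) - S (φ s (w + x')) -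
        fderiv ℝ S (φ s w) (φ s (w + x) - φ s (w + x')))
        (fderiv ℝ S (φ s w) (φ s (w + x) - φ s (w + x') - X s (x - x')))
      have h4 : ε' * ‖φ s (w + x) - φ s (w + x')‖ ≤ ε' * (‖x - x'‖ * M) := by
        gcongr; exact hlip s hs
      have h5 : K * ‖φ s (w + x) - φ s (w + x') - X s (x - x')‖ ≤
          L * ‖φ s (w + x) - φ s (w + x') - X s (x - x')‖ := by gcongr; simp [L]
      rw [map_sub (fderiv ℝ S (φ s w)) (φ s (w + x) - φ s (w + x')), sub_add_sub_cancel] at h3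
      rw [map_sub] at h2
      linarith) ht
  refine key.trans ?_
  rw [gronwallBound_of_K_ne_0 (by positivity)]
  have hc : 0 ≤ ε' * (‖x - x'‖ * M) := by positivity
  calc 0 * Real.exp (L * |t|) + ε' * (‖x - x'‖ * M) / L * (Real.exp (L * |t|) - 1)
      ≤ ε' * (‖x - x'‖ * M) * M := by
        rw [zero_mul, zero_add]
        have h1 : 0 ≤ Real.exp (L * |t|) - 1 := by
          have := Real.one_le_exp (x := L * |t|) (by positivity)
          linarith
        exact mul_le_mul (div_le_self hc hL) (by linarith [hexp t ht]) h1 hc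
    _ = ε * ‖x - x'‖ := by simp only [ε']; field_simp

/-- The flow is strictly differentiable at the points of `Λ`. -/
theorem hasStrictFDerivAt_flow (h : IsUniform S φ Λ K a b) (hw : w ∈ Λ)
    {X : ℝ → Euc n →L[ℝ] Euc n} (hX : IsVariational S φ w X) (t : ℝ) :
    HasStrictFDerivAt (fun p : Euc n × ℝ => φ p.2 (w + p.1))
      ((X t).coprod (ContinuousLinearMap.toSpanSingleton ℝ (S (φ t w)))) (0, t) := by
  rw [hasStrictFDerivAt_iff_isLittleO, Asymptotics.isLittleO_iff]
  intro c hc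
  have hc3 : 0 < c / 3 := by positivity
  obtain ⟨ρ₁, hρ₁, H₁⟩ := h.exists_norm_flow_sub_sub_le hw hX (|t| + 1) hc3
  obtain ⟨δ, hδ, Hδ⟩ := Metric.continuousAt_iff.1 (h.contDiff.continuous.continuousAt (x := φ t w))
    (c / 3) hc3
  obtain ⟨ρ₂, hρ₂, H₂⟩ := h.exists_norm_flow_sub_lt hw (|t| + 1) (half_pos hδ)
  obtain ⟨η₁, hη₁, G₁⟩ := Metric.continuousAt_iff.1 (h.continuous_orbit w).continuousAt _
    (half_pos hδ)
  obtain ⟨η₂, hη₂, G₂⟩ := Metric.continuousAt_iff.1 (hX.2 t).continuousAt _ hc3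
  set ρ := min (min ρ₁ ρ₂) (min 1 (min η₁ η₂))
  have hρ : 0 < ρ := by positivity
  have hball : Metric.ball ((0 : Euc n), t) ρ ×ˢ Metric.ball ((0 : Euc n), t) ρ ∈
      𝓝 (((0 : Euc n), t), ((0 : Euc n), t)) :=
    prod_mem_nhds (Metric.ball_mem_nhds _ hρ) (Metric.ball_mem_nhds _ hρ)
  filter_upwards [hball]
  rintro ⟨⟨x, s⟩, ⟨x', s'⟩⟩ ⟨hp, hq⟩
  rw [← ball_prod_same] at hp hq
  obtain ⟨hx, hs⟩ := hp
  obtain ⟨hx', hs'⟩ := hq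
  simp only [mem_ball_zero_iff] at hx hx'
  have e1 : ρ ≤ ρ₁ := (min_le_left _ _).trans (min_le_left _ _)
  have e2 : ρ ≤ ρ₂ := (min_le_left _ _).trans (min_le_right _ _)
  have e3 : ρ ≤ 1 := (min_le_right _ _).trans (min_le_left _ _)
  have e4 : ρ ≤ η₁ := (min_le_right _ _).trans ((min_le_right _ _).trans (min_le_left _ _))
  have e5 : ρ ≤ η₂ := (min_le_right _ _).trans ((min_le_right _ _).trans (min_le_right _ _))
  have habs : ∀ r ∈ Metric.ball t ρ, |r| ≤ |t| + 1 := fun r hr => by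
    have h1 : |r - t| < ρ := by simpa [Real.dist_eq] using hr
    have h2 := abs_add_le (r - t) t
    rw [sub_add_cancel] at h2
    linarith
  -- Three errors of size c/3: a space increment at the fixed time s, the change of X between t and
  -- s, and a time increment along the single orbit of w + x'.
  have b1 : ‖φ s (w + x) - φ s (w + x') - X s (x - x')‖ ≤ c / 3 * ‖x - x'‖ :=
    H₁ x x' (hx.trans_le e1) (hx'.trans_le e1) s (habs s hs)
  have b2 : ‖(X s - X t) (x - x')‖ ≤ c / 3 * ‖x - x'‖ := by
    refine (X s - X t).le_of_opNorm_le ?_ _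
    have := G₂ (lt_of_lt_of_le (Metric.mem_ball.1 hs) e5)
    rw [dist_eq_norm] at this
    exact this.le
  have b3 : ‖φ s (w + x') - φ s' (w + x') - (s - s') • S (φ t w)‖ ≤ c / 3 * ‖s - s'‖ := by
    have hmv := (convex_ball t ρ).norm_image_sub_le_of_norm_hasDerivWithin_le (𝕜 := ℝ)
      (f := fun r => φ r (w + x') - r • S (φ t w))
      (f' := fun r => S (φ r (w + x')) - (1 : ℝ) • S (φ t w)) (C := c / 3)
      (fun r _ => ((h.isFlow.hasDerivAt r _).sub
        ((hasDerivAt_id r).smul_const (S (φ t w)))).hasDerivWithinAt)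
      (fun r hr => by
        rw [one_smul, ← dist_eq_norm]
        refine (Hδ ?_).le
        have h1 := H₂ x' (hx'.trans_le e2) r (habs r hr)
        have h2 := G₁ (lt_of_lt_of_le (Metric.mem_ball.1 hr) e4)
        rw [← dist_eq_norm] at h1
        linarith [dist_triangle (φ r (w + x')) (φ r w) (φ t w)])
      hs' hs
    refine le_trans (le_of_eq ?_) hmv
    congr 1
    rw [sub_smul]
    abel
  have n1 : ‖x - x'‖ ≤ ‖(x, s) - (x', s')‖ := le_max_left _ _
  have n2 : ‖s - s'‖ ≤ ‖(x, s) - (x', s')‖ := le_max_right _ _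
  have hsplit : φ s (w + x) - φ s' (w + x') -
      ((X t).coprod (ContinuousLinearMap.toSpanSingleton ℝ (S (φ t w)))) ((x, s) - (x', s')) =
      (φ s (w + x) - φ s (w + x') - X s (x - x')) + (X s - X t) (x - x') +
      (φ s (w + x') - φ s' (w + x') - (s - s') • S (φ t w)) := by
    simp only [Prod.mk_sub_mk, ContinuousLinearMap.coprod_apply, sub_apply,
      ContinuousLinearMap.toSpanSingleton_apply]
    abel
  simp only
  rw [hsplit]
  refine (norm_add₃_le).trans ?_
  have m1 := mul_le_mul_of_nonneg_left n1 hc3.le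
  have m2 := mul_le_mul_of_nonneg_left n2 hc3.le
  linarith

end IsUniform

/-! ### The cross-section map and its derivative. -/

namespace IsUniform

open scoped RealInnerProductSpace

variable {n : ℕ} {S : Euc n → Euc n} {φ : ℝ → Euc n → Euc n} {Λ : Set (Euc n)} {K a b : ℝ}
  {w : Euc n}

/-- The implicit function theorem for ⟨S(φ t w), φ s (w + x) − φ t w⟩ = 0, solved for s. The
derivative in s at (0, t) is ‖S(φ t w)‖² ≠ 0, and strict differentiability at that one point
suffices. -/
theorem isTransitionTime_transitionTime (h : IsUniform S φ Λ K a b) (hw : w ∈ Λ) (t : ℝ) :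
    IsTransitionTime S φ t w (transitionTime S φ t w) := by
  refine Classical.epsilon_spec (p := IsTransitionTime S φ t w) ?_
  obtain ⟨X, hX⟩ := h.exists_isVariational hw
  have hflow : HasStrictFDerivAt (fun p : Euc n × ℝ => φ p.2 (w + p.1))
      ((X t).coprod (ContinuousLinearMap.toSpanSingleton ℝ (S (φ t w))))
      ((Transversal S w).subtypeL.prodMap (ContinuousLinearMap.id ℝ ℝ) (0, t)) := by
    simpa using h.hasStrictFDerivAt_flow hw hX t
  have hf := (innerSL ℝ (S (φ t w))).hasStrictFDerivAt.comp ((0 : Transversal S w), t)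
    ((hflow.comp _ (ContinuousLinearMap.hasStrictFDerivAt _)).sub_const (φ t w))
  have hne : ‖S (φ t w)‖ ≠ 0 := norm_ne_zero_iff.2 (h.ne_zero hw t)
  have hinv : ((innerSL ℝ (S (φ t w)) ∘L ((X t).coprod
      (ContinuousLinearMap.toSpanSingleton ℝ (S (φ t w))) ∘L
      (Transversal S w).subtypeL.prodMap (ContinuousLinearMap.id ℝ ℝ))) ∘L
      ContinuousLinearMap.inr ℝ (Transversal S w) ℝ).IsInvertible := by
    refine ContinuousLinearMap.IsInvertible.of_inverse
      (g := (‖S (φ t w)‖ ^ 2)⁻¹ • ContinuousLinearMap.id ℝ ℝ) ?_ ?_ <;>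
    · ext
      simp [hne]
  refine ⟨hf.implicitFunctionOfProdDomain hinv, ?_, ?_, ?_⟩
  · exact (hf.eventually_apply_eq_iff_implicitFunctionOfProdDomain hinv).self_of_nhds.1 rfl
  · exact (hf.hasStrictFDerivAt_implicitFunctionOfProdDomain
      hinv).hasFDerivAt.differentiableAt
  · filter_upwards [hf.eventually_apply_implicitFunctionOfProdDomain hinv] with x hx
    rw [Submodule.mem_orthogonal_singleton_iff_inner_right]
    simpa using hx

/-- Near 0 the map already takes values in the transversal space, so composing with the projection
changes nothing. The derivative of τ enters only through a multiple of S(φ t w), which the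
projection kills; the choice of τ is therefore immaterial. -/
theorem hasFDerivAt_crossMap (h : IsUniform S φ Λ K a b) (hw : w ∈ Λ)
    {X : ℝ → Euc n →L[ℝ] Euc n} (hX : IsVariational S φ w X) (t : ℝ) :
    HasFDerivAt (crossMap S φ t w)
      ((Transversal S (φ t w)).orthogonalProjectionOnto ∘L X t ∘L (Transversal S w).subtypeL) 0 := by
  obtain ⟨h0, hd, hev⟩ := h.isTransitionTime_transitionTime hw t
  set τ := transitionTime S φ t w with hτ
  have hflow : HasFDerivAt (fun p : Euc n × ℝ => φ p.2 (w + p.1))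
      ((X t).coprod (ContinuousLinearMap.toSpanSingleton ℝ (S (φ t w))))
      ((fun x : Transversal S w => ((x : Euc n), τ x)) 0) := by
    simpa [h0] using (h.hasStrictFDerivAt_flow hw hX t).hasFDerivAt
  have hpair : HasFDerivAt (fun x : Transversal S w => ((x : Euc n), τ x))
      ((Transversal S w).subtypeL.prod (fderiv ℝ τ 0)) 0 :=
    ((Transversal S w).subtypeL.hasFDerivAt).prodMk hd.hasFDerivAt
  have hcomp := ((Transversal S (φ t w)).orthogonalProjectionOnto).hasFDerivAt.comp 0
    ((hflow.comp 0 hpair).sub_const (φ t w))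
  refine (hcomp.congr_of_eventuallyEq ?_).congr_fderiv ?_
  · filter_upwards [hev] with x hx
    rw [crossMap, dif_pos hx]
    exact (Submodule.orthogonalProjectionOnto_mem_subspace_eq_self
      (⟨_, hx⟩ : Transversal S (φ t w))).symm
  · ext1 x
    have hσ : (Transversal S (φ t w)).orthogonalProjectionOnto (S (φ t w)) = 0 :=
      Submodule.orthogonalProjectionOnto_orthogonalComplement_singleton_eq_zero _
    simp [hσ]

theorem Psi_eq (h : IsUniform S φ Λ K a b) (hw : w ∈ Λ)
    {X : ℝ → Euc n →L[ℝ] Euc n} (hX : IsVariational S φ w X) (t : ℝ) :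
    Psi S φ t w = (Transversal S (φ t w)).orthogonalProjectionOnto ∘L X t ∘L
      (Transversal S w).subtypeL :=
  (h.hasFDerivAt_crossMap hw hX t).fderiv

theorem coe_Psi_apply (h : IsUniform S φ Λ K a b) (hw : w ∈ Λ)
    {X : ℝ → Euc n →L[ℝ] Euc n} (hX : IsVariational S φ w X) (t : ℝ) (x : Transversal S w) :
    (Psi S φ t w x : Euc n) =
      X t x - (⟪S (φ t w), X t x⟫ / ‖S (φ t w)‖ ^ 2) • S (φ t w) := by
  rw [h.Psi_eq hw hX t]
  simp only [ContinuousLinearMap.comp_apply, Submodule.subtypeL_apply]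
  rw [← Submodule.starProjection_apply, Submodule.starProjection_orthogonal_val,
    Submodule.starProjection_singleton]
  simp

end IsUniform

open scoped RealInnerProductSpace
open InnerProductSpace

/-! ### Gram–Schmidt in a subspace and its dependence on a parameter. -/

section GramSchmidt

variable {E : Type*} [NormedAddCommGroup E] [InnerProductSpace ℝ E]
  {ι : Type*} [LinearOrder ι] [LocallyFiniteOrderBot ι] [WellFoundedLT ι]

/-- The transversal space moves with t, so the frame can be differentiated only after passing to the
ambient space. -/
theorem coe_gramSchmidt {U : Submodule ℝ E} (f : ι → U) (i : ι) :
    ((gramSchmidt ℝ f i : U) : E) = gramSchmidt ℝ (fun j => (f j : E)) i := by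
  induction i using WellFoundedLT.induction with
  | ind i ih =>
    have h1 := congrArg (Subtype.val) (gramSchmidt_def'' ℝ f i)
    have h2 := gramSchmidt_def'' ℝ (fun j => (f j : E)) i
    rw [h2] at h1
    simp only [Submodule.coe_add, Submodule.coe_sum, Submodule.coe_smul, Submodule.coe_inner] at h1
    have h3 : ∀ j ∈ Finset.Iio i, (⟪((gramSchmidt ℝ f j : U) : E), (f i : E)⟫ /
        ((‖gramSchmidt ℝ f j‖ : ℝ) : ℝ) ^ 2) • ((gramSchmidt ℝ f j : U) : E) =
        (⟪gramSchmidt ℝ (fun j => (f j : E)) j, (f i : E)⟫ /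
          ‖gramSchmidt ℝ (fun j => (f j : E)) j‖ ^ 2) • gramSchmidt ℝ (fun j => (f j : E)) j := by
      intro j hj
      rw [← ih j (Finset.mem_Iio.1 hj)]
      rfl
    exact (add_right_cancel (h1.trans (congrArg _ (Finset.sum_congr rfl h3)))).symm

theorem coe_gramSchmidtNormed {U : Submodule ℝ E} (f : ι → U) (i : ι) :
    ((gramSchmidtNormed ℝ f i : U) : E) = gramSchmidtNormed ℝ (fun j => (f j : E)) i := by
  simp only [gramSchmidtNormed, Submodule.coe_smul, ← coe_gramSchmidt]
  rfl

theorem contDiff_gramSchmidt {z : ι → ℝ → E} {m : WithTop ℕ∞} (hz : ∀ i, ContDiff ℝ m (z i))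
    (hli : ∀ t, LinearIndependent ℝ fun i => z i t) (i : ι) :
    ContDiff ℝ m fun t => gramSchmidt ℝ (fun j => z j t) i := by
  induction i using WellFoundedLT.induction with
  | ind i ih =>
    have h : (fun t => gramSchmidt ℝ (fun j => z j t) i) = fun t => z i t -
        ∑ j ∈ Finset.Iio i, (⟪gramSchmidt ℝ (fun j => z j t) j, z i t⟫ /
          ‖gramSchmidt ℝ (fun j => z j t) j‖ ^ 2) • gramSchmidt ℝ (fun j => z j t) j := by
      funext t
      exact eq_sub_of_add_eq (gramSchmidt_def'' ℝ (fun j => z j t) i).symm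
    rw [h]
    refine (hz i).sub (ContDiff.sum fun j hj => ?_)
    have hj' := ih j (Finset.mem_Iio.1 hj)
    refine ((hj'.inner ℝ (hz i)).div (hj'.norm_sq ℝ) fun t => ?_).smul hj'
    have := gramSchmidt_ne_zero (𝕜 := ℝ) j (hli t)
    positivity

theorem contDiff_gramSchmidtNormed {z : ι → ℝ → E} {m : WithTop ℕ∞}
    (hz : ∀ i, ContDiff ℝ m (z i)) (hli : ∀ t, LinearIndependent ℝ fun i => z i t) (i : ι) :
    ContDiff ℝ m fun t => gramSchmidtNormed ℝ (fun j => z j t) i := by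
  have h := contDiff_gramSchmidt hz hli i
  have h0 : ∀ t, gramSchmidt ℝ (fun j => z j t) i ≠ 0 := fun t => gramSchmidt_ne_zero i (hli t)
  exact ((h.norm ℝ h0).inv fun t => norm_ne_zero_iff.2 (h0 t)).smul h

end GramSchmidt

theorem contDiff_one_of_hasDerivAt {E : Type*} [NormedAddCommGroup E] [NormedSpace ℝ E]
    {f f' : ℝ → E} (h : ∀ t, HasDerivAt f (f' t) t) (hc : Continuous f') : ContDiff ℝ 1 f := by
  rw [contDiff_one_iff_deriv]
  refine ⟨fun t => (h t).differentiableAt, ?_⟩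
  rwa [show deriv f = f' from funext fun t => (h t).deriv]

/-! ### Frames, coframes and the expansion of a vector along p and a frame of its orthogonal
complement. -/

section FrameMaps

variable {m : ℕ} {E : Type*} [NormedAddCommGroup E] [InnerProductSpace ℝ E]

theorem frameMap_apply {G : Type*} [NormedAddCommGroup G] [NormedSpace ℝ G] (γ : Fin m → G)
    (y : Euc m) : frameMap γ y = ∑ j, y j • γ j := by
  simp [frameMap, sum_apply]

/-- The adjoint of `frameMap e`: the components along a family of vectors. -/
def coframeMap (e : Fin m → E) : E →L[ℝ] Euc m :=
  ∑ i, ContinuousLinearMap.toSpanSingleton ℝ (EuclideanSpace.single i (1 : ℝ)) ∘L innerSL ℝ (e i)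

theorem coframeMap_apply (e : Fin m → E) (v : E) (i : Fin m) : coframeMap e v i = ⟪e i, v⟫ := by
  simp [coframeMap, sum_apply, Finset.sum_apply, Pi.single_apply]

theorem coframeMap_frameMap {e : Fin m → E} (he : Orthonormal ℝ e) (y : Euc m) :
    coframeMap e (frameMap e y) = y := by
  ext i
  rw [coframeMap_apply, frameMap_apply, he.inner_right_fintype]

theorem norm_frameMap_apply {e : Fin m → E} (he : Orthonormal ℝ e) (y : Euc m) :
    ‖frameMap e y‖ = ‖y‖ := by
  rw [← sq_eq_sq₀ (norm_nonneg _) (norm_nonneg _), ← real_inner_self_eq_norm_sq, frameMap_apply,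
    he.inner_sum, EuclideanSpace.norm_sq_eq]
  simp [sq]

theorem norm_coframeMap_apply_le {e : Fin m → E} (he : Orthonormal ℝ e) (v : E) :
    ‖coframeMap e v‖ ≤ ‖v‖ := by
  rw [← sq_le_sq₀ (norm_nonneg _) (norm_nonneg _), EuclideanSpace.norm_sq_eq]
  simp only [coframeMap_apply]
  exact he.sum_inner_products_le v

theorem norm_frameMap_apply_le {G : Type*} [NormedAddCommGroup G] [NormedSpace ℝ G]
    {γ : Fin m → G} {M : ℝ} (hM : ∀ j, ‖γ j‖ ≤ M) (y : Euc m) :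
    ‖frameMap γ y‖ ≤ m * M * ‖y‖ := by
  rw [frameMap_apply]
  refine (norm_sum_le _ _).trans ((Finset.sum_le_card_nsmul _ _ (M * ‖y‖) fun j _ => ?_).trans ?_)
  · rw [norm_smul, mul_comm]
    exact mul_le_mul (hM j) (PiLp.norm_apply_le y j) (norm_nonneg _) ((norm_nonneg _).trans (hM j))
  · simp [mul_assoc]

theorem hasDerivAt_coframeMap {e : ℝ → Fin m → E} {d : Fin m → E} {t : ℝ}
    (h : ∀ j, HasDerivAt (fun s => e s j) (d j) t) :
    HasDerivAt (fun s => coframeMap (e s)) (coframeMap d) t := by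
  unfold coframeMap
  refine HasDerivAt.fun_sum fun i _ => ?_
  exact ((ContinuousLinearMap.compL ℝ E ℝ (Euc m) (ContinuousLinearMap.toSpanSingleton ℝ
    (EuclideanSpace.single i (1 : ℝ))) ∘L innerSL ℝ).hasFDerivAt).comp_hasDerivAt t (h i)

theorem coe_frameMap {U : Submodule ℝ E} (γ : Fin m → U) (y : Euc m) :
    (frameMap γ y : E) = frameMap (fun j => (γ j : E)) y := by
  simp [frameMap_apply]

end FrameMaps

section Expansion

variable {n : ℕ} {p : Euc n}

theorem finrank_orthogonal_singleton (hp : p ≠ 0) :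
    Module.finrank ℝ (Submodule.span ℝ {p})ᗮ = n - 1 := by
  have h1 := (Submodule.span ℝ {p}).finrank_add_finrank_orthogonal
  rw [finrank_span_singleton hp, finrank_euclideanSpace_fin] at h1
  omega

theorem eq_add_sum_inner_smul (hp : p ≠ 0) {f : Fin (n - 1) → (Submodule.span ℝ {p})ᗮ}
    (hf : Orthonormal ℝ f) (v : Euc n) :
    v = (⟪p, v⟫ / ‖p‖ ^ 2) • p + frameMap (fun k => (f k : Euc n))
      (coframeMap (fun k => (f k : Euc n)) v) := by
  have hspan : Submodule.span ℝ (Set.range f) = ⊤ :=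
    hf.linearIndependent.span_eq_top_of_card_eq_finrank'
      (by rw [finrank_orthogonal_singleton hp, Fintype.card_fin])
  set o := OrthonormalBasis.mk hf hspan.ge
  have ho : ∀ k, o k = f k := fun k => by simp [o]
  have h1 := congrArg Subtype.val
    (o.sum_repr' ((Submodule.span ℝ {p})ᗮ.orthogonalProjectionOnto v))
  have h2 := (Submodule.span ℝ {p}).starProjection_add_starProjection_orthogonal v
  rw [Submodule.starProjection_singleton, Submodule.starProjection_apply, ← h1] at h2
  rw [frameMap_apply]
  refine h2.symm.trans ?_
  congr 1
  simp only [Submodule.coe_sum, Submodule.coe_smul, ho, coframeMap_apply]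
  refine Finset.sum_congr rfl fun k _ => ?_
  rw [Submodule.coe_inner]
  congr 1
  exact Submodule.inner_orthogonalProjectionOnto_eq_of_mem_left (f k) v

end Expansion

/-- The vectors of the moving frame, in the ambient space. -/
def frameVec {n : ℕ} (S : Euc n → Euc n) (φ : ℝ → Euc n → Euc n) (w : Euc n)
    (γ : Fin (n - 1) → Transversal S w) (t : ℝ) (j : Fin (n - 1)) : Euc n :=
  chi S φ w γ t j

/-- The velocities of the vectors of the moving frame. -/
def frameVel {n : ℕ} (S : Euc n → Euc n) (φ : ℝ → Euc n → Euc n) (w : Euc n)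
    (γ : Fin (n - 1) → Transversal S w) (t : ℝ) (j : Fin (n - 1)) : Euc n :=
  deriv (fun s => frameVec S φ w γ s j) t

/-! ### The moving frame and the uniform bound on its velocity. -/

namespace IsUniform

variable {n : ℕ} {S : Euc n → Euc n} {φ : ℝ → Euc n → Euc n} {Λ : Set (Euc n)} {K a b : ℝ}
  {w : Euc n} {γ : Fin (n - 1) → Transversal S w} {X : ℝ → Euc n →L[ℝ] Euc n}

/-- Both sides solve the variational equation and agree at time 0. -/
theorem variational_speed (h : IsUniform S φ Λ K a b) (hw : w ∈ Λ)
    (hX : IsVariational S φ w X) (t : ℝ) : X t (S w) = S (φ t w) := by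
  rw [← sub_eq_zero]
  refine eq_zero_of_hasDerivAt_linear (A := fun t => fderiv ℝ S (φ t w)) (t₀ := 0)
    (f := fun t => X t (S w) - S (φ t w))
    (fun t => h.norm_fderiv_le _ (h.invariant t w hw)) (fun s => ?_) ?_ t
  · rw [map_sub]
    exact (hX.hasDerivAt_apply (S w) s).sub (h.hasDerivAt_speed w s)
  · simp [hX.1, h.isFlow.zero]

theorem variational_injective (h : IsUniform S φ Λ K a b) (hw : w ∈ Λ)
    (hX : IsVariational S φ w X) {t : ℝ} {v : Euc n} (hv : X t v = 0) : v = 0 := by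
  have := eq_zero_of_hasDerivAt_linear (A := fun t => fderiv ℝ S (φ t w)) (t₀ := t)
    (f := fun t => X t v) (fun t => h.norm_fderiv_le _ (h.invariant t w hw))
    (hX.hasDerivAt_apply v) hv 0
  simpa [hX.1] using this

/-- If Ψ x = 0, then X x is a multiple of S(φ t w) = X (S w). Injectivity of X makes x a multiple of
S w, to which it is also orthogonal. -/
theorem Psi_injective (h : IsUniform S φ Λ K a b) (hw : w ∈ Λ) (t : ℝ) :
    Function.Injective (Psi S φ t w) := by
  obtain ⟨X, hX⟩ := h.exists_isVariational hw
  rw [injective_iff_map_eq_zero]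
  intro x hx
  have h1 := h.coe_Psi_apply hw hX t x
  rw [hx, Submodule.coe_zero, eq_comm, sub_eq_zero, ← h.variational_speed hw hX t, ← map_smul,
    ← sub_eq_zero, ← map_sub] at h1
  have h2 := sub_eq_zero.1 (h.variational_injective hw hX h1)
  have h3 : ⟪S w, (x : Euc n)⟫ = 0 := Submodule.mem_orthogonal_singleton_iff_inner_right.1 x.2
  have h4 : ⟪(x : Euc n), (x : Euc n)⟫ = 0 := by
    nth_rewrite 1 [h2]
    rw [inner_smul_left, h3, mul_zero]
  exact Subtype.ext (inner_self_eq_zero.1 h4)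

theorem linearIndependent_Psi (h : IsUniform S φ Λ K a b) (hw : w ∈ Λ) (hγ : Orthonormal ℝ γ)
    (t : ℝ) : LinearIndependent ℝ fun j => Psi S φ t w (γ j) :=
  hγ.linearIndependent.map' (Psi S φ t w : Transversal S w →ₗ[ℝ] Transversal S (φ t w))
    (LinearMap.ker_eq_bot.2 (h.Psi_injective hw t))

theorem linearIndependent_coe_Psi (h : IsUniform S φ Λ K a b) (hw : w ∈ Λ)
    (hγ : Orthonormal ℝ γ) (t : ℝ) :
    LinearIndependent ℝ fun j => (Psi S φ t w (γ j) : Euc n) :=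
  (h.linearIndependent_Psi hw hγ t).map' (Transversal S (φ t w)).subtype
    (Submodule.ker_subtype _)

theorem orthonormal_chi (h : IsUniform S φ Λ K a b) (hw : w ∈ Λ) (hγ : Orthonormal ℝ γ) (t : ℝ) :
    Orthonormal ℝ (chi S φ w γ t) :=
  gramSchmidtNormed_orthonormal (h.linearIndependent_Psi hw hγ t)

theorem orthonormal_frameVec (h : IsUniform S φ Λ K a b) (hw : w ∈ Λ) (hγ : Orthonormal ℝ γ)
    (t : ℝ) : Orthonormal ℝ (frameVec S φ w γ t) :=
  (h.orthonormal_chi hw hγ t).comp_linearIsometry (Transversal S (φ t w)).subtypeₗᵢ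

theorem _root_.Liao.inner_speed_frameVec (t : ℝ) (j : Fin (n - 1)) :
    ⟪S (φ t w), frameVec S φ w γ t j⟫ = 0 :=
  Submodule.mem_orthogonal_singleton_iff_inner_right.1 (chi S φ w γ t j).2

theorem _root_.Liao.frameVec_eq (t : ℝ) (j : Fin (n - 1)) :
    frameVec S φ w γ t j = gramSchmidtNormed ℝ (fun i => (Psi S φ t w (γ i) : Euc n)) j :=
  coe_gramSchmidtNormed _ _

theorem contDiff_speed (h : IsUniform S φ Λ K a b) (w : Euc n) :
    ContDiff ℝ 1 fun t => S (φ t w) :=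
  contDiff_one_of_hasDerivAt (h.hasDerivAt_speed w)
    ((h.continuous_fderiv_orbit w).clm_apply (h.contDiff.continuous.comp (h.continuous_orbit w)))

theorem contDiff_orbit (h : IsUniform S φ Λ K a b) (w : Euc n) :
    ContDiff ℝ 1 fun t => φ t w :=
  contDiff_one_of_hasDerivAt (fun t => h.isFlow.hasDerivAt t w) (h.contDiff_speed w).continuous

theorem contDiff_variational (h : IsUniform S φ Λ K a b)
    (hX : IsVariational S φ w X) (v : Euc n) : ContDiff ℝ 1 fun t => X t v :=
  contDiff_one_of_hasDerivAt (hX.hasDerivAt_apply v)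
    ((h.continuous_fderiv_orbit w).clm_apply
      (continuous_iff_continuousAt.2 fun t => (hX.hasDerivAt_apply v t).continuousAt))

theorem contDiff_frameVec (h : IsUniform S φ Λ K a b) (hw : w ∈ Λ) (hγ : Orthonormal ℝ γ)
    (j : Fin (n - 1)) : ContDiff ℝ 1 fun t => frameVec S φ w γ t j := by
  obtain ⟨X, hX⟩ := h.exists_isVariational hw
  simp only [frameVec_eq]
  refine contDiff_gramSchmidtNormed (z := fun i t => (Psi S φ t w (γ i) : Euc n)) (fun i => ?_)
    (h.linearIndependent_coe_Psi hw hγ) j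
  simp only [h.coe_Psi_apply hw hX]
  have h1 := h.contDiff_variational hX (γ i : Euc n)
  have h2 := h.contDiff_speed w
  refine h1.sub (((h2.inner ℝ h1).div (h2.norm_sq ℝ) fun t => ?_).smul h2)
  have := h.ne_zero hw t
  positivity

theorem hasDerivAt_frameVec (h : IsUniform S φ Λ K a b) (hw : w ∈ Λ) (hγ : Orthonormal ℝ γ)
    (t : ℝ) (j : Fin (n - 1)) :
    HasDerivAt (fun s => frameVec S φ w γ s j) (frameVel S φ w γ t j) t :=
  ((h.contDiff_frameVec hw hγ j).differentiable one_ne_zero t).hasDerivAt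

theorem inner_frameVel_add_inner_frameVel (h : IsUniform S φ Λ K a b) (hw : w ∈ Λ)
    (hγ : Orthonormal ℝ γ) (t : ℝ) (j k : Fin (n - 1)) :
    ⟪frameVec S φ w γ t j, frameVel S φ w γ t k⟫ +
      ⟪frameVel S φ w γ t j, frameVec S φ w γ t k⟫ = 0 := by
  have h1 := (h.hasDerivAt_frameVec hw hγ t j).inner ℝ (h.hasDerivAt_frameVec hw hγ t k)
  have h2 : (fun s => ⟪frameVec S φ w γ s j, frameVec S φ w γ s k⟫) =
      fun _ => if j = k then (1 : ℝ) else 0 :=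
    funext fun s => orthonormal_iff_ite.1 (h.orthonormal_frameVec hw hγ s) j k
  rw [h2] at h1
  exact h1.unique (hasDerivAt_const t _)

theorem inner_frameVel_speed (h : IsUniform S φ Λ K a b) (hw : w ∈ Λ)
    (hγ : Orthonormal ℝ γ) (t : ℝ) (k : Fin (n - 1)) :
    ⟪frameVel S φ w γ t k, S (φ t w)⟫ +
      ⟪frameVec S φ w γ t k, fderiv ℝ S (φ t w) (S (φ t w))⟫ = 0 := by
  have h1 := (h.hasDerivAt_frameVec hw hγ t k).inner ℝ (h.hasDerivAt_speed w t)
  have h2 : (fun s => ⟪frameVec S φ w γ s k, S (φ s w)⟫) = fun _ => (0 : ℝ) :=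
    funext fun s => by rw [real_inner_comm]; exact inner_speed_frameVec s k
  rw [h2] at h1
  have := h1.unique (hasDerivAt_const t _)
  linarith

theorem inner_frameVec_Psi_of_lt {t : ℝ} {i k : Fin (n - 1)} (hik : i < k) :
    ⟪frameVec S φ w γ t k, (Psi S φ t w (γ i) : Euc n)⟫ = 0 := by
  rw [frameVec_eq, gramSchmidtNormed, inner_smul_left,
    gramSchmidt_inv_triangular ℝ (fun i => (Psi S φ t w (γ i) : Euc n)) hik, mul_zero]

/-- The triangular structure of Gram–Schmidt, differentiated in time. It controls half of the matrix
⟨e_j, d_k⟩ by A alone, however degenerate the transported vectors are. -/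
theorem inner_frameVel_frameVec_of_lt (h : IsUniform S φ Λ K a b) (hw : w ∈ Λ)
    (hγ : Orthonormal ℝ γ) (t : ℝ) {j k : Fin (n - 1)} (hjk : j < k) :
    ⟪frameVel S φ w γ t k, frameVec S φ w γ t j⟫ +
      ⟪frameVec S φ w γ t k, fderiv ℝ S (φ t w) (frameVec S φ w γ t j)⟫ = 0 := by
  obtain ⟨X, hX⟩ := h.exists_isVariational hw
  -- `ℓ v` is the derivative of ⟨e_k, ·⟩ along the variational solution through v at time t. It
  -- vanishes wherever that pairing is identically zero.
  set ℓ : Euc n →L[ℝ] ℝ := innerSL ℝ (frameVel S φ w γ t k) +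
    innerSL ℝ (frameVec S φ w γ t k) ∘L fderiv ℝ S (φ t w) with hℓ
  have hℓσ : ℓ (S (φ t w)) = 0 := by
    simpa [hℓ] using h.inner_frameVel_speed hw hγ t k
  have hℓX : ∀ i < k, ℓ (X t (γ i)) = 0 := by
    intro i hi
    have h1 := (h.hasDerivAt_frameVec hw hγ t k).inner ℝ (hX.hasDerivAt_apply (γ i : Euc n) t)
    have h2 : (fun s => ⟪frameVec S φ w γ s k, X s (γ i)⟫) = fun _ => (0 : ℝ) := by
      funext s
      have h3 := inner_frameVec_Psi_of_lt (S := S) (φ := φ) (w := w) (γ := γ) (t := s) hi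
      rw [h.coe_Psi_apply hw hX, inner_sub_right, inner_smul_right,
        real_inner_comm (S (φ s w)), inner_speed_frameVec, mul_zero, sub_zero] at h3
      exact h3
    rw [h2] at h1
    have h4 := h1.unique (hasDerivAt_const t _)
    simp only [hℓ, add_apply, ContinuousLinearMap.comp_apply, innerSL_apply_apply]
    linarith
  have hℓz : ∀ i < k, ℓ (Psi S φ t w (γ i) : Euc n) = 0 := fun i hi => by
    rw [h.coe_Psi_apply hw hX, map_sub, map_smul, hℓX i hi, hℓσ, smul_zero, sub_zero]
  -- The vector e_j lies in the span of the Ψ u_i with i ≤ j < k, all of which `ℓ` kills.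
  have hmem : frameVec S φ w γ t j ∈ LinearMap.ker (ℓ : Euc n →ₗ[ℝ] ℝ) := by
    rw [frameVec_eq]
    refine Submodule.smul_mem _ _ ?_
    have hle : Submodule.span ℝ ((fun i => (Psi S φ t w (γ i) : Euc n)) '' Set.Iic j) ≤
        LinearMap.ker (ℓ : Euc n →ₗ[ℝ] ℝ) := by
      rw [Submodule.span_le]
      rintro _ ⟨i, hi, rfl⟩
      exact hℓz i (lt_of_le_of_lt hi hjk)
    exact hle (gramSchmidt_mem_span ℝ _ le_rfl)
  simpa [hℓ] using hmem

theorem abs_inner_fderiv_le (h : IsUniform S φ Λ K a b) (hw : w ∈ Λ) (t : ℝ) {u v : Euc n}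
    (hu : ‖u‖ = 1) : |⟪u, fderiv ℝ S (φ t w) v⟫| ≤ K * ‖v‖ := by
  have := abs_real_inner_le_norm u (fderiv ℝ S (φ t w) v)
  rw [hu, one_mul] at this
  exact this.trans (h.norm_fderiv_apply_le hw t v)

/-- Triangularity gives j < k, constant length gives j = k, and antisymmetry reduces j > k to the
first case. -/
theorem abs_inner_frameVec_frameVel_le (h : IsUniform S φ Λ K a b) (hw : w ∈ Λ)
    (hγ : Orthonormal ℝ γ) (t : ℝ) (j k : Fin (n - 1)) :
    |⟪frameVec S φ w γ t j, frameVel S φ w γ t k⟫| ≤ K := by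
  have ho := h.orthonormal_frameVec hw hγ t
  have hsum := h.inner_frameVel_add_inner_frameVel hw hγ t j k
  rcases lt_trichotomy j k with hjk | rfl | hjk
  · have h1 := h.inner_frameVel_frameVec_of_lt hw hγ t hjk
    have h2 := h.abs_inner_fderiv_le hw t (v := frameVec S φ w γ t j) (ho.1 k)
    rw [ho.1 j, mul_one] at h2
    rw [real_inner_comm, eq_neg_of_add_eq_zero_left h1, abs_neg]
    exact h2
  · rw [real_inner_comm (frameVec S φ w γ t j)] at hsum
    have : ⟪frameVec S φ w γ t j, frameVel S φ w γ t j⟫ = 0 := by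
      linarith
    rw [this, abs_zero]
    exact h.nonneg
  · have h1 := h.inner_frameVel_frameVec_of_lt hw hγ t hjk
    have h2 := h.abs_inner_fderiv_le hw t (v := frameVec S φ w γ t k) (ho.1 j)
    rw [ho.1 k, mul_one] at h2
    rw [eq_neg_of_add_eq_zero_left hsum, eq_neg_of_add_eq_zero_left h1, neg_neg]
    exact h2

theorem eq_add_frameMap_coframeMap (h : IsUniform S φ Λ K a b) (hw : w ∈ Λ)
    (hγ : Orthonormal ℝ γ) (t : ℝ) (v : Euc n) :
    v = (⟪S (φ t w), v⟫ / ‖S (φ t w)‖ ^ 2) • S (φ t w) +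
      frameMap (frameVec S φ w γ t) (coframeMap (frameVec S φ w γ t) v) :=
  eq_add_sum_inner_smul (h.ne_zero hw t) (h.orthonormal_chi hw hγ t) v

/-- The flow direction and the n − 1 frame directions each contribute at most K. -/
theorem norm_frameVel_le (h : IsUniform S φ Λ K a b) (hw : w ∈ Λ)
    (hγ : Orthonormal ℝ γ) (t : ℝ) (k : Fin (n - 1)) :
    ‖frameVel S φ w γ t k‖ ≤ n * K := by
  have ho := h.orthonormal_frameVec hw hγ t
  have hσ : 0 < ‖S (φ t w)‖ := norm_pos_iff.2 (h.ne_zero hw t)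
  rw [h.eq_add_frameMap_coframeMap hw hγ t (frameVel S φ w γ t k)]
  refine (norm_add_le _ _).trans ?_
  have h1 : ‖(⟪S (φ t w), frameVel S φ w γ t k⟫ / ‖S (φ t w)‖ ^ 2) • S (φ t w)‖ ≤ K := by
    have e1 := h.inner_frameVel_speed hw hγ t k
    have e2 := h.abs_inner_fderiv_le hw t (v := S (φ t w)) (ho.1 k)
    rw [real_inner_comm, eq_neg_of_add_eq_zero_left e1, norm_smul, norm_div, norm_neg, norm_pow,
      norm_norm, Real.norm_eq_abs, div_mul_eq_mul_div, div_le_iff₀ (by positivity)]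
    nlinarith
  have h2 : ‖frameMap (frameVec S φ w γ t) (coframeMap (frameVec S φ w γ t)
      (frameVel S φ w γ t k))‖ ≤ (n - 1 : ℕ) * K := by
    rw [frameMap_apply]
    refine (norm_sum_le _ _).trans ((Finset.sum_le_card_nsmul _ _ K fun j _ => ?_).trans ?_)
    · rw [norm_smul, ho.1 j, mul_one, coframeMap_apply]
      exact h.abs_inner_frameVec_frameVel_le hw hγ t j k
    · simp
  have hn : (n : ℝ) = (n - 1 : ℕ) + 1 := by
    have : 0 < n - 1 := k.pos
    exact_mod_cast (by omega : n = n - 1 + 1)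
  rw [hn]
  linarith

end IsUniform

theorem isInvertible_of_injective {E F : Type*} [NormedAddCommGroup E] [NormedSpace ℝ E]
    [NormedAddCommGroup F] [NormedSpace ℝ F] [FiniteDimensional ℝ E] [FiniteDimensional ℝ F]
    (hEF : Module.finrank ℝ E = Module.finrank ℝ F) {f : E →L[ℝ] F}
    (hf : ∀ x, f x = 0 → x = 0) : f.IsInvertible :=
  ⟨(LinearMap.linearEquivOfInjective (f : E →ₗ[ℝ] F)
    ((injective_iff_map_eq_zero f).2 hf) hEF).toContinuousLinearEquiv, by ext; rfl⟩

/-! ### The reduced linear system, the derivative of P and the lift in frame coordinates. -/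

namespace IsUniform

variable {n : ℕ} {S : Euc n → Euc n} {φ : ℝ → Euc n → Euc n} {Λ : Set (Euc n)} {K a b : ℝ}
  {w : Euc n} {γ : Fin (n - 1) → Transversal S w} {X : ℝ → Euc n →L[ℝ] Euc n}

theorem _root_.Liao.coframeMap_speed (t : ℝ) :
    coframeMap (frameVec S φ w γ t) (S (φ t w)) = 0 := by
  ext i
  rw [coframeMap_apply, real_inner_comm, inner_speed_frameVec]
  rfl

theorem _root_.Liao.inner_speed_frameMap (t : ℝ) (y : Euc (n - 1)) :
    ⟪S (φ t w), frameMap (frameVec S φ w γ t) y⟫ = 0 := by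
  simp [frameMap_apply, inner_sum, inner_smul_right, inner_speed_frameVec]

theorem _root_.Liao.coe_frameMap_chi (t : ℝ) (y : Euc (n - 1)) :
    (frameMap (chi S φ w γ t) y : Euc n) = frameMap (frameVec S φ w γ t) y :=
  coe_frameMap _ _

theorem frameMap_coframeMap_of_mem (h : IsUniform S φ Λ K a b) (hw : w ∈ Λ)
    (hγ : Orthonormal ℝ γ) (t : ℝ) (v : Transversal S (φ t w)) :
    frameMap (frameVec S φ w γ t) (coframeMap (frameVec S φ w γ t) v) = v := by
  have h1 := h.eq_add_frameMap_coframeMap hw hγ t (v : Euc n)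
  rw [Submodule.mem_orthogonal_singleton_iff_inner_right.1 v.2, zero_div, zero_smul,
    zero_add] at h1
  exact h1.symm

theorem inverse_frameMap_chi (h : IsUniform S φ Λ K a b) (hw : w ∈ Λ)
    (hγ : Orthonormal ℝ γ) (t : ℝ) :
    (frameMap (chi S φ w γ t)).inverse =
      coframeMap (frameVec S φ w γ t) ∘L (Transversal S (φ t w)).subtypeL := by
  refine ContinuousLinearMap.inverse_eq ?_ ?_
  · ext1 v
    refine Subtype.ext ?_
    simp only [ContinuousLinearMap.comp_apply, Submodule.subtypeL_apply, coe_frameMap_chi,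
      ContinuousLinearMap.id_apply]
    exact h.frameMap_coframeMap_of_mem hw hγ t v
  · ext1 y
    simp only [ContinuousLinearMap.comp_apply, Submodule.subtypeL_apply, coe_frameMap_chi,
      ContinuousLinearMap.id_apply]
    exact coframeMap_frameMap (h.orthonormal_frameVec hw hγ t) y

theorem frameC_apply (h : IsUniform S φ Λ K a b) (hw : w ∈ Λ)
    (hγ : Orthonormal ℝ γ) (t : ℝ) (y : Euc (n - 1)) :
    frameC S φ w γ t y =
      coframeMap (frameVec S φ w γ t) (Psi S φ t w (frameMap γ y) : Euc n) := by
  rw [frameC, h.inverse_frameMap_chi hw hγ]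
  rfl

/-- The coframe kills the flow direction, so X may replace its projection Ψ. This leaves a product
of ambient maps that can be differentiated. -/
theorem frameC_eq (h : IsUniform S φ Λ K a b) (hw : w ∈ Λ)
    (hγ : Orthonormal ℝ γ) (hX : IsVariational S φ w X) (t : ℝ) :
    frameC S φ w γ t = (coframeMap (frameVec S φ w γ t) ∘L X t) ∘L
      ((Transversal S w).subtypeL ∘L frameMap γ) := by
  ext1 y
  rw [h.frameC_apply hw hγ, h.coe_Psi_apply hw hX, map_sub, map_smul, coframeMap_speed, smul_zero,
    sub_zero]
  rfl

theorem isInvertible_frameC (h : IsUniform S φ Λ K a b) (hw : w ∈ Λ)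
    (hγ : Orthonormal ℝ γ) (t : ℝ) : (frameC S φ w γ t).IsInvertible := by
  refine isInvertible_of_injective rfl fun y hy => ?_
  rw [h.frameC_apply hw hγ] at hy
  have h1 := h.frameMap_coframeMap_of_mem hw hγ t (Psi S φ t w (frameMap γ y))
  rw [hy, map_zero] at h1
  have h2 : Psi S φ t w (frameMap γ y) = 0 := Subtype.ext h1.symm
  have h3 : frameMap γ y = 0 := h.Psi_injective hw t (by rw [h2, map_zero])
  rw [← norm_eq_zero, ← norm_frameMap_apply hγ, h3, norm_zero]

theorem coframeMap_frameVel_speed (h : IsUniform S φ Λ K a b) (hw : w ∈ Λ)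
    (hγ : Orthonormal ℝ γ) (t : ℝ) :
    coframeMap (frameVel S φ w γ t) (S (φ t w)) +
      coframeMap (frameVec S φ w γ t) (fderiv ℝ S (φ t w) (S (φ t w))) = 0 := by
  ext i
  simpa [coframeMap_apply] using h.inner_frameVel_speed hw hγ t i

theorem coframeMap_frameVel_frameMap (h : IsUniform S φ Λ K a b) (hw : w ∈ Λ)
    (hγ : Orthonormal ℝ γ) (t : ℝ) (y : Euc (n - 1)) :
    coframeMap (frameVel S φ w γ t) (frameMap (frameVec S φ w γ t) y) =
      -coframeMap (frameVec S φ w γ t) (frameMap (frameVel S φ w γ t) y) := by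
  ext i
  rw [coframeMap_apply, PiLp.neg_apply, coframeMap_apply, frameMap_apply, frameMap_apply,
    inner_sum, inner_sum, ← Finset.sum_neg_distrib]
  refine Finset.sum_congr rfl fun j _ => ?_
  rw [inner_smul_right, inner_smul_right,
    eq_neg_of_add_eq_zero_left (h.inner_frameVel_add_inner_frameVel hw hγ t i j)]
  ring

theorem hasDerivAt_frameC (h : IsUniform S φ Λ K a b) (hw : w ∈ Λ)
    (hγ : Orthonormal ℝ γ) (t : ℝ) :
    HasDerivAt (frameC S φ w γ)
      (((coframeMap (frameVel S φ w γ t) +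
        coframeMap (frameVec S φ w γ t) ∘L fderiv ℝ S (φ t w)) ∘L
        frameMap (frameVec S φ w γ t)) ∘L frameC S φ w γ t) t := by
  obtain ⟨X, hX⟩ := h.exists_isVariational hw
  have h1 := ((hasDerivAt_coframeMap (h.hasDerivAt_frameVec hw hγ t)).clm_comp (hX.2 t)).clm_comp
    (hasDerivAt_const t ((Transversal S w).subtypeL ∘L frameMap γ))
  rw [show frameC S φ w γ = fun t => (coframeMap (frameVec S φ w γ t) ∘L X t) ∘L
      ((Transversal S w).subtypeL ∘L frameMap γ) from funext (h.frameC_eq hw hγ hX)]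
  refine h1.congr_deriv ?_
  ext1 y
  have h2 := h.eq_add_frameMap_coframeMap hw hγ t (X t (frameMap γ y : Euc n))
  set v := X t (frameMap γ y : Euc n)
  set c := ⟪S (φ t w), v⟫ / ‖S (φ t w)‖ ^ 2
  -- The operator G' + G A annihilates S(φ t w), so only the frame part F G X of X survives, and G X
  -- is `frameC`.
  have h3 := congrArg (coframeMap (frameVel S φ w γ t) +
        coframeMap (frameVec S φ w γ t) ∘L fderiv ℝ S (φ t w)) h2
  rw [map_add, map_smul] at h3
  have h4 := h.coframeMap_frameVel_speed hw hγ t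
  have h5 : (coframeMap (frameVel S φ w γ t) +
        coframeMap (frameVec S φ w γ t) ∘L fderiv ℝ S (φ t w)) (S (φ t w)) = 0 := h4
  rw [h5, smul_zero, zero_add] at h3
  simp only [add_apply, ContinuousLinearMap.comp_apply, Submodule.subtypeL_apply,
    ContinuousLinearMap.comp_zero, add_zero] at h3 ⊢
  exact h3

/-- The derivative of `frameC` gives R = (G' + G A) F; orthonormality turns G' F into −G D. -/
theorem frameR_apply (h : IsUniform S φ Λ K a b) (hw : w ∈ Λ)
    (hγ : Orthonormal ℝ γ) (t : ℝ) (y : Euc (n - 1)) :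
    frameR S φ w γ t y =
      coframeMap (frameVec S φ w γ t)
        (fderiv ℝ S (φ t w) (frameMap (frameVec S φ w γ t) y)) -
      coframeMap (frameVec S φ w γ t) (frameMap (frameVel S φ w γ t) y) := by
  rw [frameR, (h.hasDerivAt_frameC hw hγ t).deriv, ContinuousLinearMap.comp_assoc,
    (h.isInvertible_frameC hw hγ t).self_comp_inverse, ContinuousLinearMap.comp_id]
  simp only [add_apply, ContinuousLinearMap.comp_apply]
  rw [h.coframeMap_frameVel_frameMap hw hγ t]
  abel

theorem _root_.Liao.frameP_eq (p : ℝ × Euc (n - 1)) :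
    frameP S φ w γ p = φ p.1 w + frameMap (frameVec S φ w γ p.1) p.2 := by
  rw [frameP, coe_frameMap_chi]

theorem contDiff_frameP (h : IsUniform S φ Λ K a b) (hw : w ∈ Λ) (hγ : Orthonormal ℝ γ) :
    ContDiff ℝ 1 (frameP S φ w γ) := by
  rw [show frameP S φ w γ = fun p => φ p.1 w + ∑ j, p.2 j • frameVec S φ w γ p.1 j from
    funext fun p => by rw [frameP_eq, frameMap_apply]]
  refine ((h.contDiff_orbit w).comp contDiff_fst).add (ContDiff.sum fun j _ => ?_)
  exact (by fun_prop : ContDiff ℝ 1 fun p : ℝ × Euc (n - 1) => p.2 j).smul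
    ((h.contDiff_frameVec hw hγ j).comp contDiff_fst)

theorem fderiv_frameP_apply (h : IsUniform S φ Λ K a b) (hw : w ∈ Λ) (hγ : Orthonormal ℝ γ)
    (t : ℝ) (y : Euc (n - 1)) (q : ℝ × Euc (n - 1)) :
    fderiv ℝ (frameP S φ w γ) (t, y) q =
      q.1 • (S (φ t w) + frameMap (frameVel S φ w γ t) y) +
        frameMap (frameVec S φ w γ t) q.2 := by
  rw [show frameP S φ w γ = fun p => φ p.1 w + ∑ j, p.2 j • frameVec S φ w γ p.1 j from
    funext fun p => by rw [frameP_eq, frameMap_apply]]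
  have hfst (f : ℝ → Euc n) (f' : Euc n) (hf : HasDerivAt f f' t) :
      HasFDerivAt (fun p : ℝ × Euc (n - 1) => f p.1)
        (ContinuousLinearMap.toSpanSingleton ℝ f' ∘L ContinuousLinearMap.fst ℝ ℝ (Euc (n - 1)))
        (t, y) :=
    HasFDerivAt.comp (t, y) (g := f) hf.hasFDerivAt hasFDerivAt_fst
  have h1 := hfst _ _ (h.isFlow.hasDerivAt t w)
  have h2 := fun j => hfst _ _ (h.hasDerivAt_frameVec hw hγ t j)
  have h3 : ∀ j : Fin (n - 1), HasFDerivAt (fun p : ℝ × Euc (n - 1) => p.2 j) _ (t, y) := fun j =>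
    ((EuclideanSpace.proj j : Euc (n - 1) →L[ℝ] ℝ) ∘L
      ContinuousLinearMap.snd ℝ ℝ (Euc (n - 1))).hasFDerivAt
  rw [(h1.fun_add (HasFDerivAt.fun_sum (u := Finset.univ) fun j _ => (h3 j).fun_smul (h2 j))).fderiv]
  simp only [add_apply, sum_apply, frameMap_apply, smul_add, Finset.smul_sum]
  simp [Finset.sum_add_distrib, smul_smul, mul_comm, add_assoc]

/-- Pairing a kernel vector with S(φ t w) removes the frame part, so the time component vanishes;
the rest vanishes because the frame map is isometric. -/
theorem isInvertible_fderiv_frameP (h : IsUniform S φ Λ K a b) (hw : w ∈ Λ)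
    (hγ : Orthonormal ℝ γ) (hn : n ≠ 0) {t : ℝ} {y : Euc (n - 1)}
    (hy : ‖S (φ t w)‖ ^ 2 + ⟪S (φ t w), frameMap (frameVel S φ w γ t) y⟫ ≠ 0) :
    (fderiv ℝ (frameP S φ w γ) (t, y)).IsInvertible := by
  refine isInvertible_of_injective ?_ fun q hq => ?_
  · simp only [Module.finrank_prod, Module.finrank_self, finrank_euclideanSpace_fin]
    omega
  · rw [h.fderiv_frameP_apply hw hγ] at hq
    have h1 := congrArg (inner ℝ (S (φ t w))) hq
    rw [inner_add_right, inner_smul_right, inner_add_right, inner_speed_frameMap,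
      real_inner_self_eq_norm_sq, inner_zero_right, add_zero] at h1
    have h2 : q.1 = 0 := (mul_eq_zero.1 h1).resolve_right hy
    rw [h2, zero_smul, zero_add] at hq
    refine Prod.ext h2 ?_
    rw [Prod.snd_zero, ← norm_eq_zero, ← norm_frameMap_apply (h.orthonormal_frameVec hw hγ t), hq,
      norm_zero]

section Lift

variable {V : Euc n → Euc n} {t : ℝ} {y : Euc (n - 1)}

theorem lift_eq (h : IsUniform S φ Λ K a b) (hw : w ∈ Λ) (hγ : Orthonormal ℝ γ)
    (hinv : (fderiv ℝ (frameP S φ w γ) (t, y)).IsInvertible) :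
    (lift S φ V w γ (t, y)).1 • (S (φ t w) + frameMap (frameVel S φ w γ t) y) +
        frameMap (frameVec S φ w γ t) (lift S φ V w γ (t, y)).2 =
      V (φ t w + frameMap (frameVec S φ w γ t) y) := by
  rw [← h.fderiv_frameP_apply hw hγ, lift, hinv.self_apply_inverse, frameP_eq]

theorem lift_fst_mul (h : IsUniform S φ Λ K a b) (hw : w ∈ Λ) (hγ : Orthonormal ℝ γ)
    (hinv : (fderiv ℝ (frameP S φ w γ) (t, y)).IsInvertible) :
    (lift S φ V w γ (t, y)).1 *
        (‖S (φ t w)‖ ^ 2 + ⟪S (φ t w), frameMap (frameVel S φ w γ t) y⟫) =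
      ⟪S (φ t w), V (φ t w + frameMap (frameVec S φ w γ t) y)⟫ := by
  rw [← h.lift_eq (V := V) hw hγ hinv, inner_add_right, inner_smul_right, inner_add_right,
    inner_speed_frameMap, real_inner_self_eq_norm_sq, add_zero]

/-- The term G D y occurs in both the standard system and R y and cancels, so the frame velocity
enters the remainder only through the scalar lift component. -/
theorem stdRem_eq (h : IsUniform S φ Λ K a b) (hw : w ∈ Λ) (hγ : Orthonormal ℝ γ)
    (hinv : (fderiv ℝ (frameP S φ w γ) (t, y)).IsInvertible)
    (h0 : (lift S φ V w γ (t, y)).1 ≠ 0) :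
    stdRem S φ V w γ t y =
      (lift S φ V w γ (t, y)).1⁻¹ • coframeMap (frameVec S φ w γ t)
        (V (φ t w + frameMap (frameVec S φ w γ t) y)) -
      coframeMap (frameVec S φ w γ t)
        (fderiv ℝ S (φ t w) (frameMap (frameVec S φ w γ t) y)) := by
  rw [stdRem, stdSys, h.frameR_apply hw hγ, ← h.lift_eq (V := V) hw hγ hinv]
  simp only [map_add, map_smul, smul_add, coframeMap_speed, smul_zero, zero_add,
    coframeMap_frameMap (h.orthonormal_frameVec hw hγ t), inv_smul_smul₀ h0]
  abel

end Lift

end IsUniform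

/-! ### C¹-neighborhoods and the abstract Lipschitz estimate. -/

theorem norm_le_of_c1Norm_lt {n : ℕ} {X : Euc n → Euc n} {r : ℝ}
    (h : c1Norm X < ENNReal.ofReal r) (w : Euc n) : ‖X w‖ ≤ r ∧ ‖fderiv ℝ X w‖ ≤ r := by
  have hr : 0 ≤ r := (ENNReal.ofReal_pos.1 (bot_le.trans_lt h)).le
  have h1 : ‖X w‖ₑ + ‖fderiv ℝ X w‖ₑ ≤ ENNReal.ofReal r :=
    (le_iSup (fun w => ‖X w‖ₑ + ‖fderiv ℝ X w‖ₑ) w).trans h.le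
  constructor
  · rw [← ENNReal.ofReal_le_ofReal_iff hr, ofReal_norm]
    exact le_self_add.trans h1
  · rw [← ENNReal.ofReal_le_ofReal_iff hr, ofReal_norm]
    exact le_add_self.trans h1

theorem isC1Nhd_ball {n : ℕ} (S : Euc n → Euc n) {r : ℝ} (hr : 0 < r) :
    IsC1Nhd S {V | ContDiff ℝ 1 V ∧ c1Norm (V - S) < ENNReal.ofReal r} :=
  ⟨fun _ hV => ⟨hV.1, hV.2.trans ENNReal.ofReal_lt_top⟩, ENNReal.ofReal r,
    ENNReal.ofReal_pos.2 hr, fun _ h1 h2 => ⟨h1, h2⟩⟩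

theorem IsC1Nhd.inter {n : ℕ} {S : Euc n → Euc n} {N N' : Set (Euc n → Euc n)}
    (h : IsC1Nhd S N) (h' : IsC1Nhd S N') : IsC1Nhd S (N ∩ N') := by
  obtain ⟨h1, r, hr, h2⟩ := h
  obtain ⟨-, r', hr', h2'⟩ := h'
  exact ⟨fun V hV => h1 V hV.1, min r r', lt_min hr hr', fun V hV hlt =>
    ⟨h2 V hV (hlt.trans_le (min_le_left _ _)), h2' V hV (hlt.trans_le (min_le_right _ _))⟩⟩

/-- The Lipschitz estimate for `y ↦ (s y)⁻¹ • G (g y) - G (A (F y))` at a pair of points. -/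
theorem norm_remainder_sub_le {E H : Type*} [NormedAddCommGroup E] [InnerProductSpace ℝ E]
    [NormedAddCommGroup H] [NormedSpace ℝ H] {σ : E} {A : E →L[ℝ] E} {F D : H →L[ℝ] E}
    {G : E →L[ℝ] H} {a b K M ε ρ ξ : ℝ} (ha : 0 < a) (hσa : a ≤ ‖σ‖) (hσb : ‖σ‖ ≤ b)
    (hK : 0 ≤ K) (hM : 0 ≤ M) (hε : 0 ≤ ε) (hG : ∀ v, ‖G v‖ ≤ ‖v‖) (hGσ : G σ = 0)
    (hF : ∀ y, ‖F y‖ = ‖y‖) (hD : ∀ y, ‖D y‖ ≤ M * ‖y‖) (hA : ∀ v, ‖A v‖ ≤ K * ‖v‖)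
    (hξ : b * M * ξ ≤ a ^ 2 / 4) {y y' : H} (hy : ‖y‖ ≤ ξ) {g g' : E} {s s' : ℝ}
    (hs : s * (‖σ‖ ^ 2 + ⟪σ, D y⟫) = ⟪σ, g⟫) (hs' : s' * (‖σ‖ ^ 2 + ⟪σ, D y'⟫) = ⟪σ, g'⟫)
    (hs1 : 1 / 2 ≤ s) (hs1' : 1 / 2 ≤ s')
    (hg : ‖g - g' - A (F (y - y'))‖ ≤ ε * ‖y - y'‖) (hgσ : ‖g - σ‖ ≤ ρ) (hgσ' : ‖g' - σ‖ ≤ ρ) :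
    ‖(s⁻¹ • G g - G (A (F y))) - (s'⁻¹ • G g' - G (A (F y')))‖ ≤
      (2 * ε + 8 * b / (3 * a ^ 2) * ((M * ξ + ρ) * K + ρ * (M + 2 * (K + ε)))) * ‖y - y'‖ := by
  have hb : 0 < b := ha.trans_le (hσa.trans hσb)
  have hρ : 0 ≤ ρ := (norm_nonneg _).trans hgσ
  have hinner : ∀ v, |⟪σ, v⟫| ≤ b * ‖v‖ := fun v =>
    (abs_real_inner_le_norm σ v).trans (by gcongr)
  have hs0 : 0 < s := by linarith
  have hs0' : 0 < s' := by linarith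
  have hq2 : s⁻¹ ≤ 2 := (inv_le_comm₀ hs0 two_pos).2 (by linarith)
  have hq2' : s'⁻¹ ≤ 2 := (inv_le_comm₀ hs0' two_pos).2 (by linarith)
  have hq0 : 0 < s⁻¹ := inv_pos.2 hs0
  have hq0' : 0 < s'⁻¹ := inv_pos.2 hs0'
  set q := s⁻¹
  set q' := s'⁻¹
  have hDy : ‖D y‖ ≤ M * ξ := (hD y).trans (by gcongr)
  have hden : 3 / 4 * a ^ 2 ≤ ‖σ‖ ^ 2 + ⟪σ, D y⟫ := by
    have h1 := neg_le_of_abs_le ((hinner (D y)).trans (mul_le_mul_of_nonneg_left hDy hb.le))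
    have h2 : a ^ 2 ≤ ‖σ‖ ^ 2 := by gcongr
    linarith
  have hN : 3 / 8 * a ^ 2 ≤ ⟪σ, g⟫ := by rw [← hs]; nlinarith [sq_nonneg a]
  have hqN : q * ⟪σ, g⟫ = ‖σ‖ ^ 2 + ⟪σ, D y⟫ := by rw [← hs, inv_mul_cancel_left₀ hs0.ne']
  have hqN' : q' * ⟪σ, g'⟫ = ‖σ‖ ^ 2 + ⟪σ, D y'⟫ := by rw [← hs', inv_mul_cancel_left₀ hs0'.ne']
  -- Division by ⟨σ, g⟩ ≥ 3a²/8 is the source of the constant 8b/(3a²). The lower bound combines s ≥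
  -- 1/2 with the denominator bound 3a²/4.
  have hμ : ∀ u z : ℝ, 0 ≤ z → |⟪σ, g⟫ * u| ≤ b * z → |u| ≤ 8 * b / (3 * a ^ 2) * z := by
    intro u z hz hu
    have hpos : 0 < 3 / 8 * a ^ 2 := by positivity
    rw [abs_mul, abs_of_pos (hpos.trans_le hN)] at hu
    have h1 : 3 / 8 * a ^ 2 * |u| ≤ b * z :=
      (mul_le_mul_of_nonneg_right hN (abs_nonneg u)).trans hu
    rw [div_mul_eq_mul_div, le_div_iff₀ (by positivity)]
    linarith
  have hAF : ‖A (F (y - y'))‖ ≤ K * ‖y - y'‖ := by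
    rw [← hF (y - y')]
    exact hA _
  have hgg : ‖g - g'‖ ≤ (K + ε) * ‖y - y'‖ := by
    have := norm_add_le (g - g' - A (F (y - y'))) (A (F (y - y')))
    rw [sub_add_cancel] at this
    linarith
  have hq1 : |q - 1| ≤ 8 * b / (3 * a ^ 2) * (M * ξ + ρ) := by
    refine hμ _ _ (add_nonneg ((norm_nonneg _).trans hDy) hρ) ?_
    have h1 : ⟪σ, g⟫ * (q - 1) = ⟪σ, D y⟫ - ⟪σ, g - σ⟫ := by
      rw [inner_sub_right, real_inner_self_eq_norm_sq]
      linear_combination hqN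
    rw [h1]
    have h2 := abs_sub ⟪σ, D y⟫ ⟪σ, g - σ⟫
    have h3 := (hinner (D y)).trans (mul_le_mul_of_nonneg_left hDy hb.le)
    have h4 := (hinner (g - σ)).trans (mul_le_mul_of_nonneg_left hgσ hb.le)
    linarith
  have hqq : |q - q'| ≤ 8 * b / (3 * a ^ 2) * ((M + 2 * (K + ε)) * ‖y - y'‖) := by
    refine hμ _ _ (by positivity) ?_
    have h1 : ⟪σ, g⟫ * (q - q') = ⟪σ, D (y - y')⟫ - q' * ⟪σ, g - g'⟫ := by
      rw [map_sub, inner_sub_right, inner_sub_right]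
      linear_combination hqN - hqN'
    rw [h1]
    have h2 := abs_sub ⟪σ, D (y - y')⟫ (q' * ⟪σ, g - g'⟫)
    have h3 := (hinner (D (y - y'))).trans (mul_le_mul_of_nonneg_left (hD _) hb.le)
    have h4 := (hinner (g - g')).trans (mul_le_mul_of_nonneg_left hgg hb.le)
    rw [abs_mul, abs_of_pos hq0'] at h2
    have h5 : q' * |⟪σ, g - g'⟫| ≤ 2 * (b * ((K + ε) * ‖y - y'‖)) :=
      mul_le_mul hq2' h4 (abs_nonneg _) two_pos.le
    linarith
  -- Since G σ = 0, the last term may carry g' − σ instead of g', which makes it small.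
  have hsplit : (q • G g - G (A (F y))) - (q' • G g' - G (A (F y'))) =
      q • G (g - g' - A (F (y - y'))) + (q - 1) • G (A (F (y - y'))) + (q - q') • G (g' - σ) := by
    simp only [map_sub, hGσ, smul_sub, sub_smul, one_smul, smul_zero]
    abel
  rw [hsplit]
  refine norm_add₃_le.trans ?_
  rw [norm_smul, norm_smul, norm_smul, Real.norm_of_nonneg hq0.le, Real.norm_eq_abs,
    Real.norm_eq_abs]
  have t1 : q * ‖G (g - g' - A (F (y - y')))‖ ≤ 2 * (ε * ‖y - y'‖) :=
    mul_le_mul hq2 ((hG _).trans hg) (norm_nonneg _) two_pos.le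
  have t2 : |q - 1| * ‖G (A (F (y - y')))‖ ≤
      8 * b / (3 * a ^ 2) * (M * ξ + ρ) * (K * ‖y - y'‖) :=
    mul_le_mul hq1 ((hG _).trans hAF) (norm_nonneg _) ((abs_nonneg _).trans hq1)
  have t3 : |q - q'| * ‖G (g' - σ)‖ ≤
      8 * b / (3 * a ^ 2) * ((M + 2 * (K + ε)) * ‖y - y'‖) * ρ :=
    mul_le_mul hqq ((hG _).trans hgσ') (norm_nonneg _) ((abs_nonneg _).trans hqq)
  linarith

/-! ### Estimates uniform over frames: tube radius, time bounds, remainder. -/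

namespace IsUniform

variable {n : ℕ} {S : Euc n → Euc n} {φ : ℝ → Euc n → Euc n} {Λ : Set (Euc n)} {K a b : ℝ}
  {w : Euc n} {γ : Fin (n - 1) → Transversal S w} {V : Euc n → Euc n} {r : ℝ}

theorem norm_frameMap_frameVel_le (h : IsUniform S φ Λ K a b) (hw : w ∈ Λ)
    (hγ : Orthonormal ℝ γ) (t : ℝ) (y : Euc (n - 1)) :
    ‖frameMap (frameVel S φ w γ t) y‖ ≤ (n - 1 : ℕ) * (n * K) * ‖y‖ :=
  norm_frameMap_apply_le (h.norm_frameVel_le hw hγ t) y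

theorem abs_inner_speed_le (h : IsUniform S φ Λ K a b) (hw : w ∈ Λ) (t : ℝ) (v : Euc n) :
    |⟪S (φ t w), v⟫| ≤ b * ‖v‖ :=
  (abs_real_inner_le_norm _ v).trans (by gcongr; exact h.speed_le _ (h.invariant t w hw))

theorem abs_inner_speed_frameVel_le (h : IsUniform S φ Λ K a b) (hw : w ∈ Λ)
    (hγ : Orthonormal ℝ γ) (hb : 0 ≤ b) (t : ℝ) {y : Euc (n - 1)} {ξ : ℝ} (hy : ‖y‖ ≤ ξ) :
    |⟪S (φ t w), frameMap (frameVel S φ w γ t) y⟫| ≤ b * ((n - 1 : ℕ) * (n * K)) * ξ := by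
  have hK := h.nonneg
  rw [mul_assoc]
  exact (h.abs_inner_speed_le hw t _).trans (by
    gcongr
    exact (h.norm_frameMap_frameVel_le hw hγ t y).trans (by gcongr))

theorem norm_sub_sub_fderiv_le (h : IsUniform S φ Λ K a b) (hV : ContDiff ℝ 1 V)
    (hr : ∀ v, ‖fderiv ℝ (V - S) v‖ ≤ r) {p v v' : Euc n} {ε : ℝ}
    (hS : ‖S v - S v' - fderiv ℝ S p (v - v')‖ ≤ ε * ‖v - v'‖) :
    ‖V v - V v' - fderiv ℝ S p (v - v')‖ ≤ (ε + r) * ‖v - v'‖ := by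
  have h1 := convex_univ.norm_image_sub_le_of_norm_fderiv_le (𝕜 := ℝ) (f := V - S) (x := v')
    (y := v) (fun x _ => ((hV.differentiable one_ne_zero).sub h.differentiable) x)
    (fun x _ => hr x) trivial trivial
  have h2 : V v - V v' - fderiv ℝ S p (v - v') =
      (S v - S v' - fderiv ℝ S p (v - v')) + ((V - S) v - (V - S) v') := by
    simp only [Pi.sub_apply]
    abel
  rw [h2, add_mul]
  exact (norm_add_le _ _).trans (add_le_add hS h1)

/-- The `C¹` size of the remainder on a tube of radius `ξ`. -/
theorem norm_stdRem_sub_le (h : IsUniform S φ Λ K a b) (hw : w ∈ Λ) (hγ : Orthonormal ℝ γ)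
    (hV : ContDiff ℝ 1 V) (hr0 : ∀ v, ‖(V - S) v‖ ≤ r) (hr : ∀ v, ‖fderiv ℝ (V - S) v‖ ≤ r)
    {δ ε ξ : ℝ} (hδ : 0 < δ) (hε : 0 ≤ ε)
    (hS : ∀ p ∈ Λ, ∀ v v' : Euc n, ‖v - p‖ < δ → ‖v' - p‖ < δ →
      ‖S v - S v' - fderiv ℝ S p (v - v')‖ ≤ ε * ‖v - v'‖) (hξδ : ξ ≤ δ)
    (hξ : b * ((n - 1 : ℕ) * (n * K)) * ξ ≤ a ^ 2 / 4) {t : ℝ} {y y' : Euc (n - 1)}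
    (hy : ‖y‖ < ξ) (hy' : ‖y'‖ < ξ)
    (hinv : (fderiv ℝ (frameP S φ w γ) (t, y)).IsInvertible)
    (hinv' : (fderiv ℝ (frameP S φ w γ) (t, y')).IsInvertible)
    (hs : 1 / 2 ≤ (lift S φ V w γ (t, y)).1) (hs' : 1 / 2 ≤ (lift S φ V w γ (t, y')).1) :
    ‖stdRem S φ V w γ t y - stdRem S φ V w γ t y'‖ ≤
      (2 * (ε + r) + 8 * b / (3 * a ^ 2) *
        (((n - 1 : ℕ) * (n * K) * ξ + (r + (K + ε) * ξ)) * K +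
          (r + (K + ε) * ξ) * ((n - 1 : ℕ) * (n * K) + 2 * (K + (ε + r))))) * ‖y - y'‖ := by
  have hK := h.nonneg
  have hrnn : 0 ≤ r := (norm_nonneg _).trans (hr0 0)
  have ho := h.orthonormal_frameVec hw hγ t
  have hp := h.invariant t w hw
  have hmem : ∀ z : Euc (n - 1), ‖z‖ < ξ →
      ‖φ t w + frameMap (frameVec S φ w γ t) z - φ t w‖ < δ := fun z hz => by
    rw [add_sub_cancel_left, norm_frameMap_apply ho]
    exact hz.trans_le hξδ
  have hgσ : ∀ z : Euc (n - 1), ‖z‖ < ξ →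
      ‖V (φ t w + frameMap (frameVec S φ w γ t) z) - S (φ t w)‖ ≤ r + (K + ε) * ξ := by
    intro z hz
    have h1 := h.norm_sub_le_of_norm_sub_sub_le hw
      (hS _ hp _ (φ t w) (hmem z hz) (by simpa using hδ))
    rw [add_sub_cancel_left, norm_frameMap_apply ho] at h1
    have h2 := hr0 (φ t w + frameMap (frameVec S φ w γ t) z)
    have h3 := norm_add_le ((V - S) (φ t w + frameMap (frameVec S φ w γ t) z))
      (S (φ t w + frameMap (frameVec S φ w γ t) z) - S (φ t w))
    rw [Pi.sub_apply, sub_add_sub_cancel] at h3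
    have h4 : (K + ε) * ‖z‖ ≤ (K + ε) * ξ := by gcongr
    rw [Pi.sub_apply] at h2
    linarith
  have hsplit : φ t w + frameMap (frameVec S φ w γ t) y -
      (φ t w + frameMap (frameVec S φ w γ t) y') = frameMap (frameVec S φ w γ t) (y - y') := by
    rw [map_sub]
    abel
  have hg := h.norm_sub_sub_fderiv_le hV hr (hS _ hp _ _ (hmem y hy) (hmem y' hy'))
  rw [hsplit, norm_frameMap_apply ho] at hg
  rw [h.stdRem_eq hw hγ hinv (by linarith), h.stdRem_eq hw hγ hinv' (by linarith)]
  exact norm_remainder_sub_le h.pos (h.le_speed _ hp) (h.speed_le _ hp) hK (by positivity)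
    (by positivity) (norm_coframeMap_apply_le ho) (coframeMap_speed t) (norm_frameMap_apply ho)
    (h.norm_frameMap_frameVel_le hw hγ t) (h.norm_fderiv_apply_le hw t) hξ hy.le
    (h.lift_fst_mul hw hγ hinv) (h.lift_fst_mul hw hγ hinv') hs hs' hg (hgσ y hy)
    (hgσ y' hy')

/-- On the orbit itself the coframe kills S, so only V − S contributes, multiplied by an inverse
time component of at most 2. -/
theorem norm_stdRem_zero_le (h : IsUniform S φ Λ K a b) (hw : w ∈ Λ) (hγ : Orthonormal ℝ γ)
    (hr0 : ∀ v, ‖(V - S) v‖ ≤ r) {t : ℝ}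
    (hinv : (fderiv ℝ (frameP S φ w γ) (t, 0)).IsInvertible)
    (hs : 1 / 2 ≤ (lift S φ V w γ (t, 0)).1) :
    ‖stdRem S φ V w γ t 0‖ ≤ 2 * r := by
  have hs0 : 0 < (lift S φ V w γ (t, 0)).1 := by linarith
  rw [h.stdRem_eq hw hγ hinv hs0.ne']
  simp only [map_zero, add_zero, sub_zero]
  rw [norm_smul, norm_inv, Real.norm_of_nonneg hs0.le]
  have h1 : coframeMap (frameVec S φ w γ t) (V (φ t w)) =
      coframeMap (frameVec S φ w γ t) ((V - S) (φ t w)) := by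
    rw [Pi.sub_apply, map_sub, coframeMap_speed, sub_zero]
  rw [h1]
  exact mul_le_mul ((inv_le_comm₀ hs0 two_pos).2 (by linarith))
    ((norm_coframeMap_apply_le (h.orthonormal_frameVec hw hγ t) _).trans (hr0 _))
    (norm_nonneg _) two_pos.le

theorem isTubeRadius (h : IsUniform S φ Λ K a b) (hb : 0 ≤ b) (hn : n ≠ 0) {c : ℝ}
    (hc : b * ((n - 1 : ℕ) * (n * K)) * c ≤ a ^ 2 / 4) : IsTubeRadius S φ Λ c := by
  refine fun w hw γ hγ => ⟨h.contDiff_frameP hw hγ, fun t y hy => ?_⟩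
  refine h.isInvertible_fderiv_frameP hw hγ hn (ne_of_gt ?_)
  have h1 := neg_le_of_abs_le
    (h.abs_inner_speed_frameVel_le hw hγ hb t (mem_ball_zero_iff.1 hy).le)
  have h2 : a ^ 2 ≤ ‖S (φ t w)‖ ^ 2 :=
    pow_le_pow_left₀ h.pos.le (h.le_speed _ (h.invariant t w hw)) 2
  have := pow_pos h.pos 2
  linarith

theorem hasTimeBounds (h : IsUniform S φ Λ K a b) (hb : 0 ≤ b) (hn : n ≠ 0) {δ c r : ℝ}
    (hδ : 0 < δ) (hS : ∀ p ∈ Λ, ∀ v v' : Euc n, ‖v - p‖ < δ → ‖v' - p‖ < δ →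
      ‖S v - S v' - fderiv ℝ S p (v - v')‖ ≤ 1 * ‖v - v'‖) (hcδ : c ≤ δ)
    (hc : b * ((n - 1 : ℕ) * (n * K)) * c ≤ a ^ 2 / 4)
    (hr : b * (r + (K + 1) * c) ≤ a ^ 2 / 4) :
    HasTimeBounds S φ Λ c {V | ContDiff ℝ 1 V ∧ c1Norm (V - S) < ENNReal.ofReal r} := by
  rintro V ⟨-, hVS⟩ w hw γ hγ t y hy
  have hinv := (h.isTubeRadius hb hn hc w hw γ hγ).2 t y hy
  rw [mem_ball_zero_iff] at hy
  have hK := h.nonneg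
  have ho := h.orthonormal_frameVec hw hγ t
  have hp := h.invariant t w hw
  have h1 := abs_le.1 (h.abs_inner_speed_frameVel_le hw hγ hb t hy.le)
  have h2 : a ^ 2 ≤ ‖S (φ t w)‖ ^ 2 := pow_le_pow_left₀ h.pos.le (h.le_speed _ hp) 2
  have ha := pow_pos h.pos 2
  have hmul := h.lift_fst_mul (V := V) hw hγ hinv
  set v := φ t w + frameMap (frameVec S φ w γ t) y with hv
  have hvp : ‖v - φ t w‖ = ‖y‖ := by rw [hv, add_sub_cancel_left, norm_frameMap_apply ho]
  have h3 := h.norm_sub_le_of_norm_sub_sub_le hw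
    (hS _ hp v (φ t w) (by rw [hvp]; exact hy.trans_le hcδ) (by simpa using hδ))
  rw [hvp] at h3
  have h4 : ‖V v - S (φ t w)‖ ≤ r + (K + 1) * c := by
    have e1 := (norm_le_of_c1Norm_lt hVS v).1
    have e2 := norm_add_le ((V - S) v) (S v - S (φ t w))
    rw [Pi.sub_apply, sub_add_sub_cancel] at e2
    have e3 : (K + 1) * ‖y‖ ≤ (K + 1) * c := by gcongr
    rw [Pi.sub_apply] at e1
    linarith
  have h5 := abs_le.1 ((h.abs_inner_speed_le hw t (V v - S (φ t w))).trans
    ((mul_le_mul_of_nonneg_left h4 hb).trans hr))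
  rw [inner_sub_right, real_inner_self_eq_norm_sq] at h5
  set s := (lift S φ V w γ (t, y)).1
  set d := ‖S (φ t w)‖ ^ 2 + ⟪S (φ t w), frameMap (frameVel S φ w γ t) y⟫ with hd
  -- The denominator d and the numerator ⟨σ, V⟩ both lie within a factor 3/4 to 5/4 of ‖σ‖², so the
  -- quotient lies in [3/5, 5/3].
  have hd1 : 3 / 4 * ‖S (φ t w)‖ ^ 2 ≤ d := by linarith
  have hd2 : d ≤ 5 / 4 * ‖S (φ t w)‖ ^ 2 := by linarith
  have hd0 : 0 < d := by linarith
  constructor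
  · refine le_of_mul_le_mul_right ?_ hd0
    linarith
  · refine le_of_mul_le_mul_right ?_ hd0
    linarith

end IsUniform

end

end Liao

/-! ### The theorem: choice of constants. -/

theorem theorem2p13 {n : ℕ} (hn : 2 ≤ n)
    (S : Liao.Euc n → Liao.Euc n) (hS : ContDiff ℝ 1 S)
    (φ : ℝ → Liao.Euc n → Liao.Euc n) (hφ : Liao.IsFlow S φ)
    (Λ : Set (Liao.Euc n)) (hΛ : IsClosed Λ) (hinv : ∀ t : ℝ, ∀ w ∈ Λ, φ t w ∈ Λ)
    (hU1 : Liao.CondU1 S Λ) (hU2 : Liao.CondU2 S Λ) (hU3 : Liao.CondU3 S Λ) :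
    ∃ c₀ : ℝ, 0 < c₀ ∧ ∀ c : ℝ, 0 < c → c ≤ c₀ →
      Liao.IsTubeRadius S φ Λ c ∧
      (∃ N, Liao.IsC1Nhd S N ∧ Liao.HasTimeBounds S φ Λ c N) ∧
      ∀ N, Liao.IsC1Nhd S N → Liao.HasTimeBounds S φ Λ c N →
        (∀ V ∈ N, ∀ w ∈ Λ, ∀ γ : Fin (n - 1) → Liao.Transversal S w, Orthonormal ℝ γ →
          ∃ L : ℝ, 0 < L ∧ ∀ t : ℝ,
            ∀ y ∈ Metric.ball (0 : Liao.Euc (n - 1)) c,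
            ∀ y' ∈ Metric.ball (0 : Liao.Euc (n - 1)) c,
              ‖Liao.stdRem S φ V w γ t y - Liao.stdRem S φ V w γ t y'‖ ≤ L * ‖y - y'‖) ∧
        (∀ η : ℝ, 0 < η → ∃ U, U ⊆ N ∧ Liao.IsC1Nhd S U ∧ ∃ ξ : ℝ, 0 < ξ ∧ ξ ≤ c ∧
          ∀ V ∈ U, ∀ w ∈ Λ, ∀ γ : Fin (n - 1) → Liao.Transversal S w, Orthonormal ℝ γ →
            ∀ t : ℝ, ∀ y ∈ Metric.ball (0 : Liao.Euc (n - 1)) ξ,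
              ‖Liao.stdRem S φ V w γ t y‖ ≤ η * ξ) ∧
        (∀ κ : ℝ, 0 < κ → ∃ U, U ⊆ N ∧ Liao.IsC1Nhd S U ∧ ∃ ξ : ℝ, 0 < ξ ∧ ξ ≤ c ∧
          ∀ V ∈ U, ∀ w ∈ Λ, ∀ γ : Fin (n - 1) → Liao.Transversal S w, Orthonormal ℝ γ →
            ∀ t : ℝ, ∀ y ∈ Metric.ball (0 : Liao.Euc (n - 1)) ξ,
            ∀ y' ∈ Metric.ball (0 : Liao.Euc (n - 1)) ξ,
              ‖Liao.stdRem S φ V w γ t y - Liao.stdRem S φ V w γ t y'‖ ≤ κ * ‖y - y'‖) := by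
  have hn0 : n ≠ 0 := by omega
  obtain ⟨K₀, hK₀⟩ := hU1
  obtain ⟨a, b₀, ha, hab⟩ := hU2
  set K := max K₀ 0
  set b := max b₀ 0
  have hK : 0 ≤ K := le_max_right _ _
  have hb : 0 ≤ b := le_max_right _ _
  have h : Liao.IsUniform S φ Λ K a b :=
    ⟨hS, hφ, hinv, hK, fun w hw => (hK₀ w hw).trans (le_max_left _ _), ha,
      fun w hw => (hab w hw).1, fun w hw => (hab w hw).2.trans (le_max_left _ _), hU3⟩
  obtain ⟨δ₁, hδ₁, H₁⟩ := h.exists_norm_sub_sub_le one_pos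
  set M : ℝ := (n - 1 : ℕ) * (n * K)
  have hM : 0 ≤ M := by positivity
  -- The bound b(M + K + 1)c ≤ a²/8 controls both the frame velocity term and half of the budget
  -- a²/4 for V − σ; the C¹-radius uses the other half. The added 1 keeps the denominator positive
  -- when b = 0.
  set c₀ := min δ₁ (a ^ 2 / (8 * (b * (M + K + 1) + 1)))
  refine ⟨c₀, lt_min hδ₁ (by positivity), fun c hc hcc => ?_⟩
  have hcδ : c ≤ δ₁ := hcc.trans (min_le_left _ _)
  have hcb : b * (M + K + 1) * c ≤ a ^ 2 / 8 := by
    have h1 : c ≤ a ^ 2 / (8 * (b * (M + K + 1) + 1)) := hcc.trans (min_le_right _ _)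
    rw [le_div_iff₀ (by positivity)] at h1
    linarith
  have hcM : b * M * c ≤ a ^ 2 / 4 := by
    have : 0 ≤ b * (K + 1) * c := by positivity
    have := pow_pos ha 2
    linarith
  have hcK : b * ((K + 1) * c) ≤ a ^ 2 / 8 := by
    have : 0 ≤ b * M * c := by positivity
    linarith
  have htube := h.isTubeRadius hb hn0 hcM
  refine ⟨htube, ⟨_, Liao.isC1Nhd_ball S (r := a ^ 2 / (8 * (b + 1))) (by positivity),
    h.hasTimeBounds hb hn0 hδ₁ H₁ hcδ hcM ?_⟩, fun N hN hTB => ?_⟩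
  · have : b * (a ^ 2 / (8 * (b + 1))) ≤ a ^ 2 / 8 := by
      rw [mul_div_assoc', div_le_div_iff₀ (by positivity) (by positivity)]
      have := pow_pos ha 2
      linarith
    linarith
  have hLip : ∀ κ : ℝ, 0 < κ → ∃ U, U ⊆ N ∧ Liao.IsC1Nhd S U ∧ ∃ ξ : ℝ, 0 < ξ ∧ ξ ≤ c ∧
      ∀ V ∈ U, ∀ w ∈ Λ, ∀ γ : Fin (n - 1) → Liao.Transversal S w, Orthonormal ℝ γ →
        ∀ t : ℝ, ∀ y ∈ Metric.ball (0 : Liao.Euc (n - 1)) ξ,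
        ∀ y' ∈ Metric.ball (0 : Liao.Euc (n - 1)) ξ,
          ‖Liao.stdRem S φ V w γ t y - Liao.stdRem S φ V w γ t y'‖ ≤ κ * ‖y - y'‖ := by
    intro κ hκ
    -- One number `θ` ≤ 1 serves as (U3) error, as C¹-radius and as a bound for `ξ`. The Lipschitz
    -- constant is then at most Q θ.
    set Q := 4 + 8 * b / (3 * a ^ 2) *
      ((M + (K + 2)) * K + (K + 2) * (M + 2 * (K + 2))) with hQ
    have hQ0 : 0 < Q := by positivity
    set θ := min 1 (κ / Q)
    have hθ : 0 < θ := by positivity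
    have hθ1 : θ ≤ 1 := min_le_left _ _
    have hθQ : Q * θ ≤ κ := by
      have : θ ≤ κ / Q := min_le_right _ _
      rwa [le_div_iff₀ hQ0, mul_comm] at this
    obtain ⟨δ, hδ, H⟩ := h.exists_norm_sub_sub_le hθ
    set ξ := min (min θ δ) c
    have hξ : 0 < ξ := by positivity
    have hξθ : ξ ≤ θ := (min_le_left _ _).trans (min_le_left _ _)
    have hξδ : ξ ≤ δ := (min_le_left _ _).trans (min_le_right _ _)
    have hξc : ξ ≤ c := min_le_right _ _
    refine ⟨_, inter_subset_left, hN.inter (Liao.isC1Nhd_ball S hθ), ξ, hξ, hξc, ?_⟩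
    rintro V ⟨hVN, hV, hVS⟩ w hw γ hγ t y hy y' hy'
    have hyc := Metric.ball_subset_ball hξc hy
    have hyc' := Metric.ball_subset_ball hξc hy'
    have hT := (htube w hw γ hγ).2 t
    have hB := hTB V hVN w hw γ hγ t
    refine (h.norm_stdRem_sub_le hw hγ hV (fun v => (Liao.norm_le_of_c1Norm_lt hVS v).1)
      (fun v => (Liao.norm_le_of_c1Norm_lt hVS v).2) hδ hθ.le H hξδ
      ((mul_le_mul_of_nonneg_left hξc (by positivity)).trans hcM)
      (mem_ball_zero_iff.1 hy) (mem_ball_zero_iff.1 hy') (hT y hyc) (hT y' hyc')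
      (hB y hyc).1 (hB y' hyc').1).trans (mul_le_mul_of_nonneg_right ?_ (norm_nonneg _))
    have e1 : θ + (K + θ) * ξ ≤ (K + 2) * θ := by
      have : (K + θ) * ξ ≤ (K + 1) * θ := by gcongr
      linarith
    have e2 : 0 ≤ θ + (K + θ) * ξ := by positivity
    calc 2 * (θ + θ) + 8 * b / (3 * a ^ 2) * ((M * ξ + (θ + (K + θ) * ξ)) * K +
          (θ + (K + θ) * ξ) * (M + 2 * (K + (θ + θ))))
        ≤ 2 * (θ + θ) + 8 * b / (3 * a ^ 2) * ((M * θ + (K + 2) * θ) * K +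
          ((K + 2) * θ) * (M + 2 * (K + (1 + 1)))) := by gcongr
      _ = Q * θ := by rw [hQ]; ring
      _ ≤ κ := hθQ
  refine ⟨fun V hVN w hw γ hγ => ?_, fun η hη => ?_, hLip⟩
  · obtain ⟨hV, hVfin⟩ := hN.1 V hVN
    -- V need not be close to S here: any finite C¹-distance works, with error 1 in (U3) on the
    -- whole tube. The 1 added makes the inequality strict.
    set r := (Liao.c1Norm (V - S)).toReal + 1
    have hr : 0 < r := by positivity
    have hVS : Liao.c1Norm (V - S) < ENNReal.ofReal r := by
      rw [ENNReal.lt_ofReal_iff_toReal_lt hVfin.ne]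
      exact lt_add_one _
    refine ⟨2 * (1 + r) + 8 * b / (3 * a ^ 2) * ((M * c + (r + (K + 1) * c)) * K +
      (r + (K + 1) * c) * (M + 2 * (K + (1 + r)))), by positivity, fun t y hy y' hy' => ?_⟩
    have hT := (htube w hw γ hγ).2 t
    have hB := hTB V hVN w hw γ hγ t
    exact h.norm_stdRem_sub_le hw hγ hV (fun v => (Liao.norm_le_of_c1Norm_lt hVS v).1)
      (fun v => (Liao.norm_le_of_c1Norm_lt hVS v).2) hδ₁ zero_le_one H₁ hcδ hcM
      (mem_ball_zero_iff.1 hy) (mem_ball_zero_iff.1 hy') (hT y hy) (hT y' hy')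
      (hB y hy).1 (hB y' hy').1
  -- The Lipschitz bound contributes ηξ/2 and the value at 0 contributes 2 · ηξ/4. The tube radius
  -- `ξ` is fixed first and the neighborhood is then shrunk in terms of it.
  · obtain ⟨U, hUN, hU, ξ, hξ, hξc, HU⟩ := hLip (η / 2) (half_pos hη)
    have hr : 0 < η * ξ / 4 := by positivity
    refine ⟨_, inter_subset_left.trans hUN, hU.inter (Liao.isC1Nhd_ball S hr), ξ, hξ, hξc, ?_⟩
    rintro V ⟨hVU, -, hVS⟩ w hw γ hγ t y hy
    have h0c : (0 : Liao.Euc (n - 1)) ∈ Metric.ball 0 c := Metric.mem_ball_self hc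
    have h1 := HU V hVU w hw γ hγ t y hy 0 (Metric.mem_ball_self hξ)
    have h2 := h.norm_stdRem_zero_le hw hγ (fun v => (Liao.norm_le_of_c1Norm_lt hVS v).1)
      ((htube w hw γ hγ).2 t 0 h0c) (hTB V (hUN hVU) w hw γ hγ t 0 h0c).1
    have h3 : η / 2 * ‖y - 0‖ ≤ η / 2 * ξ := by
      rw [sub_zero]
      exact mul_le_mul_of_nonneg_left (mem_ball_zero_iff.1 hy).le (half_pos hη).le
    have h4 := norm_add_le (Liao.stdRem S φ V w γ t y - Liao.stdRem S φ V w γ t 0)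
      (Liao.stdRem S φ V w γ t 0)
    rw [sub_add_cancel] at h4
    linarith
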